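/- Let $\mathbb T=\mathbb R/2\pi\mathbb Z$ and let $u(y)=\sum_{n=1}^{\infty}a_n\sin(3^n y)$, where $a_n\in\mathbb R$ satisfy $$3^{-n\alpha}\le |a_n|\le C_0\,3^{-n\alpha},\qquad 1\le \frac{|a_n|}{|a_{n+1}|}\le 3\qquad(n\ge 1)$$ for some constants $\alpha\in(0,1)$ and $C_0>1$. For $\nu>0$, let $S_\nu(t)$ and $R_\nu(t)$, $t\ge 0$, be the strongly continuous semigroups on $L^2(\mathbb T^2)$ (complex-valued functions of $(x,y)$) generated by the equations $$\partial_t f-\nu\Delta f+u(y)\partial_x f=0\qquad\text{and}\qquad \partial_t f-\nu\partial_y^2 f+u(y)\partial_x f=0,$$ that is, by the operators $\nu\Delta-u(y)\partial_x$ and $\nu\partial_y^2-u(y)\partial_x$, each taken in the sense of distributions with domain all $f\in L^2(\mathbb T^2)$ that it maps into $L^2(\mathbb T^2)$. Let $P_k$ be the orthogonal projection of $L^2(\mathbb T^2)$ onto the $k$-th Fourier mode in $x$, i.e. onto the functions of the form $e^{ikx}g(y)$. Then these semigroups exist, and there are constants $\varepsilon,C>0$ such that for every $\nu>0$ and every integer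 $k\ne 0$ with $\nu|k|^{-1}\le 1/2$, $$\|S_\nu(t)P_k\|_{L^2\to L^2}\le C e^{-\varepsilon\widetilde\lambda_{\nu,k}t},\qquad \|R_\nu(t)P_k\|_{L^2\to L^2}\le C e^{-\varepsilon\widetilde\lambda_{\nu,k}t}\qquad\text{for all }t\ge 0,$$ where $\widetilde\lambda_{\nu,k}=\nu^{\frac{\alpha}{\alpha+2}}|k|^{\frac{2}{\alpha+2}}$. -/

import Mathlib

open Real Set Filter Topology MeasureTheory
open scoped ENNReal

noncomputable section

namespace ShearFlow

instance instFactTwoPiPos : Fact (0 < 2 * π) := Fact.mk Real.two_pi_pos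

/-- The circle `ℝ / 2πℤ`. -/
abbrev Circ : Type := AddCircle (2 * π)

/-- The torus `𝕋²`, with coordinates `(x, y)`. -/
abbrev Torus : Type := Circ × Circ

/-- The complex Hilbert space `L²(𝕋²)`, for the Lebesgue measure `dx dy` on `𝕋²`. -/
abbrev L2Torus : Type := Lp ℂ 2 (volume : Measure Torus)

/-- The character `(x, y) ↦ e^{i(jx + ly)}` of the torus, as a continuous function. -/
def character (j l : ℤ) : C(Torus, ℂ) where
  toFun p := fourier j p.1 * fourier l p.2
  continuous_toFun := by fun_prop

/-- The character `(x, y) ↦ e^{i(jx + ly)}` as an element of `L²(𝕋²)`. -/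
def characterLp (j l : ℤ) : L2Torus :=
  ContinuousMap.toLp 2 (volume : Measure Torus) ℂ (character j l)

/-- The functions in `L²(𝕋²)` of the form `e^{ikx} g(y)`: the closed linear span of the
characters `e^{i(kx + ly)}`, `l ∈ ℤ`. -/
def modeSubspace (k : ℤ) : Submodule ℂ L2Torus :=
  (Submodule.span ℂ (range (characterLp k))).topologicalClosure

instance instCompleteSpaceModeSubspace (k : ℤ) : CompleteSpace (modeSubspace k) :=
  inferInstanceAs (CompleteSpace (Submodule.topologicalClosure _))

/-- `P_k`, the (orthogonal) projection of `L²(𝕋²)` to the `k`-th Fourier mode in `x`. -/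
def modeProj (k : ℤ) : L2Torus →L[ℂ] L2Torus :=
  (modeSubspace k).starProjection

/-- The graph, in `L²(𝕋²) × L²(𝕋²)`, of the operator
`f ↦ κ ∂ₓ² f + ν ∂_y² f - u(y) ∂ₓ f`
with its natural domain, that is all `f ∈ L²(𝕋²)` for which this distribution on `𝕋²` lies in
`L²(𝕋²)`. The equation `g = κ ∂ₓ² f + ν ∂_y² f - u(y) ∂ₓ f` between distributions on the torus is
tested against the functions `e^{-i(jx + ly)}`, `j l ∈ ℤ` (whose span is dense in the smooth
functions on the torus), all derivatives being moved to the test function. -/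
def advectionDiffusionGraph (κ ν : ℝ) (u : Circ → ℝ) : Set (L2Torus × L2Torus) :=
  {q | ∀ j l : ℤ,
    ∫ p : Torus, q.2 p * character (-j) (-l) p =
      ∫ p : Torus, q.1 p *
        (-(κ * (j : ℂ) ^ 2 + ν * (l : ℂ) ^ 2) * character (-j) (-l) p
          + u p.2 * (-(Complex.I * j) * character (-j) (-l) p))}

/-- The operator `ν Δ - u(y) ∂ₓ`, for the equation `∂ₜ f - ν Δ f + u(y) ∂ₓ f = 0`. -/
def driftDiffusionGraph (ν : ℝ) (u : Circ → ℝ) : Set (L2Torus × L2Torus) :=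
  advectionDiffusionGraph ν ν u

/-- The operator `ν ∂_y² - u(y) ∂ₓ`, for the equation `∂ₜ f - ν ∂_y² f + u(y) ∂ₓ f = 0`. -/
def hypoellipticGraph (ν : ℝ) (u : Circ → ℝ) : Set (L2Torus × L2Torus) :=
  advectionDiffusionGraph 0 ν u

/-- `S(t)`, `t ≥ 0`, is a strongly continuous semigroup of bounded operators whose infinitesimal
generator is the operator with graph `A`: the right derivative at `t = 0` of `t ↦ S(t) f` exists
and is `g` exactly when `(f, g) ∈ A`. Values of `S` at negative times are irrelevant. -/
structure IsSemigroupGeneratedBy {X : Type*} [NormedAddCommGroup X] [NormedSpace ℂ X]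
    (S : ℝ → X →L[ℂ] X) (A : Set (X × X)) : Prop where
  map_zero : S 0 = ContinuousLinearMap.id ℂ X
  map_add : ∀ s t : ℝ, 0 ≤ s → 0 ≤ t → S (s + t) = (S s).comp (S t)
  continuousOn : ∀ f : X, ContinuousOn (fun t : ℝ => S t f) (Ici 0)
  generator : ∀ f g : X,
    Tendsto (fun h : ℝ => ((h⁻¹ : ℝ) : ℂ) • (S h f - f)) (𝓝[>] 0) (𝓝 g) ↔ (f, g) ∈ A

end ShearFlow

end

/-! The velocity `u` is only Hölder of exponent α, so the usual hypocoercivity argument, built on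
the commutator of ∂_y with u ∂ₓ, has no u' to use. A finite translation T_s in y replaces the
derivative. On the k-th mode the transport term is multiplication by i k u, and commuting it with
T_s produces the increment w = u(· + s) - u. Along the flow, the functional ‖f‖² + b Im⟨f, w T_s f⟩
has a derivative containing -b k Re⟨w f, w T_s f⟩ (`inner_commutator`), which is -b k ‖w f‖² up to
errors controlled by s ‖∂_y f‖.

Lacunarity makes this usable. For s = 2π/3^(M+2) every frequency from 3^(M+2) on is s-periodic and
drops out (`increment_eq_incr`), so w is a trigonometric polynomial, of size s^α with derivative of
size s^(α-1) (`exists_increment`). It may vanish at points, but not at four consecutive translates: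
its own increment is dominated by the frequency 3^(M+1), for which s is a third of a period. A
second difference gains a factor 9 per step down in frequency, while the coefficients grow by at
most 3 (`exists_abs_incr_sub_incr_ge`). Moving the translates from w onto f costs s ‖∂_y f‖, so ‖w
f‖² controls s^(2α) ‖f‖² modulo a diffusive error (`coercivity`).

The scale δ = (ν/|k|)^(1/(α+2)) balances ν δ⁻² = |k| δ^α, and the common value is the claimed rate.
With s comparable to δ and b a small multiple of δ^(-α), every term is of the order of the rate
times ‖f‖² + δ² ‖∂_y f‖², and the smallness of b closes the estimate (`scaled_dissipation`).
Diffusion in x acts on a mode as a nonpositive scalar and only helps, so both semigroups are treated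
at once, with coefficient κ = ν or κ = 0.

Existence is the Lumer–Phillips theorem, proved through Yosida approximations. The operator is
closed and dissipative, and its adjoint is of the same type with u replaced by -u, which makes r - A
surjective. -/

noncomputable section

namespace ShearFlow

open scoped InnerProductSpace ComplexConjugate

/-! ### Exponentials of bounded dissipative operators -/

section Yosida

variable {X : Type*} [NormedAddCommGroup X] [InnerProductSpace ℂ X]

/-- The norm is nonincreasing along a differentiable curve whose velocity is dissipative. -/
theorem norm_le_of_dissipative_curve {v v' : ℝ → X} (hv : ∀ t, HasDerivAt v (v' t) t)
    (h : ∀ t, (⟪v t, v' t⟫_ℂ).re ≤ 0) {t : ℝ} (ht : 0 ≤ t) : ‖v t‖ ≤ ‖v 0‖ := by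
  have hd : ∀ s, HasDerivAt (fun s => ‖v s‖ ^ 2) (2 * (⟪v s, v' s⟫_ℂ).re) s := by
    intro s
    have h1 := Complex.reCLM.hasFDerivAt.comp_hasDerivAt s ((hv s).inner ℂ (hv s))
    have h2 : (fun s => ‖v s‖ ^ 2) = fun s => (⟪v s, v s⟫_ℂ).re := by
      ext s; rw [← @inner_self_eq_norm_sq ℂ]; rfl
    rw [h2]
    refine h1.congr_deriv ?_
    have : (⟪v' s, v s⟫_ℂ).re = (⟪v s, v' s⟫_ℂ).re := inner_re_symm (𝕜 := ℂ) _ _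
    rw [Complex.reCLM_apply, Complex.add_re, this]
    ring
  have hanti : Antitone (fun s => ‖v s‖ ^ 2) :=
    antitone_of_hasDerivAt_nonpos hd fun s => by have := h s; simp only [Pi.zero_apply]; linarith
  exact le_of_sq_le_sq (hanti ht) (norm_nonneg _)

variable [CompleteSpace X]

/-- The uniformly continuous semigroup `exp (t B)` of a bounded operator. -/
def expSemigroup (B : X →L[ℂ] X) (t : ℝ) : X →L[ℂ] X := NormedSpace.exp (t • B)

theorem expSemigroup_zero (B : X →L[ℂ] X) : expSemigroup B 0 = 1 := by
  simp [expSemigroup, NormedSpace.exp_zero]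

theorem expSemigroup_add (B : X →L[ℂ] X) (s t : ℝ) :
    expSemigroup B (s + t) = expSemigroup B s * expSemigroup B t := by
  let _ : NormedAlgebra ℚ (X →L[ℂ] X) := NormedAlgebra.restrictScalars ℚ ℝ _
  rw [expSemigroup, add_smul]
  exact NormedSpace.exp_add_of_commute (((Commute.refl B).smul_left s).smul_right t)

theorem commute_expSemigroup {B B' : X →L[ℂ] X} (h : Commute B B') (t : ℝ) :
    Commute B (expSemigroup B' t) :=
  (h.smul_right t).exp_right

theorem hasDerivAt_expSemigroup (B : X →L[ℂ] X) (f : X) (t : ℝ) :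
    HasDerivAt (fun s => expSemigroup B s f) (B (expSemigroup B t f)) t := by
  have h := hasDerivAt_exp_smul_const' (𝕂 := ℝ) B t
  have h2 := ((ContinuousLinearMap.apply ℂ X f).restrictScalars ℝ).hasFDerivAt.comp_hasDerivAt t h
  exact h2

theorem norm_expSemigroup_apply_le {B : X →L[ℂ] X} (hB : ∀ f, (⟪f, B f⟫_ℂ).re ≤ 0) (f : X)
    {t : ℝ} (ht : 0 ≤ t) : ‖expSemigroup B t f‖ ≤ ‖f‖ := by
  have := norm_le_of_dissipative_curve (hasDerivAt_expSemigroup B f) (fun _ => hB _) ht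
  simpa [expSemigroup_zero] using this

/-- Interpolate by s ↦ exp(sB) exp((t-s)B') f. Since B and B' commute, its derivative is this
product of contractions applied to B f - B' f. -/
theorem norm_expSemigroup_sub_le {B B' : X →L[ℂ] X} (hB : ∀ f, (⟪f, B f⟫_ℂ).re ≤ 0)
    (hB' : ∀ f, (⟪f, B' f⟫_ℂ).re ≤ 0) (hc : Commute B B') (f : X) {t : ℝ} (ht : 0 ≤ t) :
    ‖expSemigroup B t f - expSemigroup B' t f‖ ≤ t * ‖B f - B' f‖ := by
  have hd : ∀ s, HasDerivAt (fun s => expSemigroup B s (expSemigroup B' (t - s) f))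
      (expSemigroup B s (expSemigroup B' (t - s) (B f - B' f))) s := by
    intro s
    have h1 := hasDerivAt_exp_smul_const' (𝕂 := ℝ) B s
    have h2 := (hasDerivAt_exp_smul_const' (𝕂 := ℝ) B' (t - s)).scomp s
      ((hasDerivAt_id s).const_sub t)
    have h3 := h1.mul h2
    have h4 := ((ContinuousLinearMap.apply ℂ X f).restrictScalars ℝ).hasFDerivAt.comp_hasDerivAt s h3
    refine h4.congr_deriv ?_
    have e1 : ∀ g, B (expSemigroup B s g) = expSemigroup B s (B g) := fun g =>
      congrArg (fun T : X →L[ℂ] X => T g) (commute_expSemigroup (Commute.refl B) s).eq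
    have e2 : ∀ g, B (expSemigroup B' (t - s) g) = expSemigroup B' (t - s) (B g) := fun g =>
      congrArg (fun T : X →L[ℂ] X => T g) (commute_expSemigroup hc (t - s)).eq
    have e3 : ∀ g, B' (expSemigroup B' (t - s) g) = expSemigroup B' (t - s) (B' g) := fun g =>
      congrArg (fun T : X →L[ℂ] X => T g) (commute_expSemigroup (Commute.refl B') (t - s)).eq
    change B (expSemigroup B s (expSemigroup B' (t - s) f)) +
      expSemigroup B s (((-1 : ℝ) • (B' * expSemigroup B' (t - s))) f) = _
    have e4 : ((-1 : ℝ) • (B' * expSemigroup B' (t - s))) f = -expSemigroup B' (t - s) (B' f) := by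
      rw [neg_one_smul]
      exact congrArg Neg.neg (e3 f)
    rw [e1, e2, e4, map_sub, map_sub, map_neg, ← sub_eq_add_neg]
  have hb := norm_image_sub_le_of_norm_deriv_le_segment' (a := 0) (b := t)
    (C := ‖B f - B' f‖) (fun s _ => (hd s).hasDerivWithinAt) (fun s hs => by
      refine (norm_expSemigroup_apply_le hB _ hs.1).trans
        (norm_expSemigroup_apply_le hB' _ ?_)
      linarith [hs.2]) t ⟨ht, le_rfl⟩
  simpa [expSemigroup_zero, mul_comm] using hb

theorem norm_expSemigroup_sub_self_le {B : X →L[ℂ] X} (hB : ∀ f, (⟪f, B f⟫_ℂ).re ≤ 0) (f : X)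
    {t : ℝ} (ht : 0 ≤ t) : ‖expSemigroup B t f - f‖ ≤ t * ‖B f‖ := by
  have h0 : ∀ g : X, (⟪g, (0 : X →L[ℂ] X) g⟫_ℂ).re ≤ 0 := fun g => by simp
  simpa [expSemigroup] using norm_expSemigroup_sub_le hB h0 (Commute.zero_right B) f ht

end Yosida

/-! ### The Lumer–Phillips theorem -/

section LumerPhillips

variable {X : Type*} [NormedAddCommGroup X] [InnerProductSpace ℂ X]

/-- A linear relation is maximal dissipative when it is dissipative and each `r - A`, `r > 0`, is
onto. -/
structure IsMaxDissipative (A : Submodule ℂ (X × X)) : Prop where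
  re_inner_nonpos : ∀ q ∈ A, (⟪q.1, q.2⟫_ℂ).re ≤ 0
  exists_resolvent : ∀ r : ℝ, 0 < r → ∀ g : X, ∃ q ∈ A, (r : ℂ) • q.1 - q.2 = g
  dense_domain : Dense {f : X | ∃ g, (f, g) ∈ A}

namespace IsMaxDissipative

variable {A : Submodule ℂ (X × X)}

theorem norm_fst_le (hA : ∀ q ∈ A, (⟪q.1, q.2⟫_ℂ).re ≤ 0) {r : ℝ} (hr : 0 < r) {q : X × X}
    (hq : q ∈ A) : ‖q.1‖ ≤ r⁻¹ * ‖(r : ℂ) • q.1 - q.2‖ := by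
  have h1 : r * ‖q.1‖ ^ 2 ≤ (⟪q.1, (r : ℂ) • q.1 - q.2⟫_ℂ).re := by
    have h2 : (⟪q.1, q.1⟫_ℂ) = ((‖q.1‖ ^ 2 : ℝ) : ℂ) := by
      rw [inner_self_eq_norm_sq_to_K]; norm_cast
    rw [inner_sub_right, inner_smul_right, h2, ← Complex.ofReal_mul, Complex.sub_re,
      Complex.ofReal_re]
    linarith [hA q hq]
  have h3 : (⟪q.1, (r : ℂ) • q.1 - q.2⟫_ℂ).re ≤ ‖q.1‖ * ‖(r : ℂ) • q.1 - q.2‖ :=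
    (Complex.re_le_norm _).trans (norm_inner_le_norm _ _)
  rw [inv_mul_eq_div, le_div_iff₀ hr]
  rcases (norm_nonneg q.1).eq_or_lt with h | h
  · rw [← h]; simp
  · nlinarith

variable (hA : IsMaxDissipative A)
include hA

/-- The resolvent exists as a bounded operator. -/
theorem exists_resolvent_clm {r : ℝ} (hr : 0 < r) : ∃ R : X →L[ℂ] X,
    (∀ g, (R g, (r : ℂ) • R g - g) ∈ A) ∧
    (∀ q ∈ A, R ((r : ℂ) • q.1 - q.2) = q.1) ∧ ∀ g, ‖R g‖ ≤ r⁻¹ * ‖g‖ := by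
  choose q hq hqg using hA.exists_resolvent r hr
  have huniq : ∀ p ∈ A, ∀ p' ∈ A, (r : ℂ) • p.1 - p.2 = (r : ℂ) • p'.1 - p'.2 → p.1 = p'.1 := by
    intro p hp p' hp' h
    have := norm_fst_le hA.re_inner_nonpos hr (A.sub_mem hp hp')
    have h0 : (r : ℂ) • (p - p').1 - (p - p').2 = 0 := by
      rw [Prod.fst_sub, Prod.snd_sub, smul_sub]
      rw [← sub_eq_zero] at h
      rw [← h]; abel
    rw [h0, norm_zero, mul_zero] at this
    simpa [sub_eq_zero] using this
  have hmem : ∀ g, ((q g).1, (r : ℂ) • (q g).1 - g) ∈ A := by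
    intro g
    have : (r : ℂ) • (q g).1 - g = (q g).2 := by
      nth_rewrite 2 [← hqg g]; abel
    rw [this]; exact hq g
  refine ⟨LinearMap.mkContinuous
    { toFun := fun g => (q g).1
      map_add' := fun g g' => huniq _ (hq _) _ (A.add_mem (hq g) (hq g')) (by
        rw [hqg, Prod.fst_add, Prod.snd_add, smul_add]
        nth_rewrite 1 [← hqg g, ← hqg g']; abel)
      map_smul' := fun c g => huniq _ (hq _) _ (A.smul_mem c (hq g)) (by
        rw [hqg, Prod.smul_fst, Prod.smul_snd, smul_comm, ← smul_sub, hqg]) } r⁻¹ ?_,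
    hmem, ?_, ?_⟩
  · intro g
    have := norm_fst_le hA.re_inner_nonpos hr (hq g)
    rwa [hqg] at this
  · intro p hp
    exact huniq _ (hq _) _ hp (hqg _)
  · intro g
    have := norm_fst_le hA.re_inner_nonpos hr (hq g)
    rwa [hqg] at this

/-- Yosida approximations. -/
theorem exists_yosida : ∃ B : ℕ → X →L[ℂ] X,
    (∀ n f, (⟪f, B n f⟫_ℂ).re ≤ 0) ∧ (∀ n m, Commute (B n) (B m)) ∧
    ∀ q ∈ A, Tendsto (fun n => B n q.1) atTop (𝓝 q.2) := by
  have hpos : ∀ n : ℕ, (0 : ℝ) < (n : ℝ) + 1 := fun n => by positivity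
  choose R hR1 hR2 hR3 using fun n : ℕ => hA.exists_resolvent_clm (hpos n)
  -- The shift by one keeps the resolvent parameter positive at n = 0.
  set c : ℕ → ℂ := fun n => (((n : ℝ) + 1 : ℝ) : ℂ) with hc
  have hcn : ∀ n, ‖c n‖ = (n : ℝ) + 1 := fun n => by
    rw [hc]; simp only [Complex.norm_real, Real.norm_eq_abs, abs_of_pos (hpos n)]
  have hJ : ∀ n g, ‖c n • R n g‖ ≤ ‖g‖ := by
    intro n g
    rw [norm_smul, hcn]
    calc ((n : ℝ) + 1) * ‖R n g‖ ≤ ((n : ℝ) + 1) * (((n : ℝ) + 1)⁻¹ * ‖g‖) := by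
          gcongr; exact hR3 n g
      _ = ‖g‖ := by field_simp
  have hcomm : ∀ n m, Commute (R n) (R m) := by
    intro n m
    -- The resolvent identity; its left side is antisymmetric in n and m, which forces R n and R m
    -- to commute.
    have key : ∀ n m g, R m g - R n g = (c n - c m) • R n (R m g) := by
      intro n m g
      have h1 := hR2 n _ (hR1 m g)
      have h2 : (((n : ℝ) + 1 : ℝ) : ℂ) • (R m g, (((m : ℝ) + 1 : ℝ) : ℂ) • R m g - g).1 -
        (R m g, (((m : ℝ) + 1 : ℝ) : ℂ) • R m g - g).2 = (c n - c m) • R m g + g := by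
        simp only [hc, sub_smul]; abel
      rw [h2, map_add, map_smul] at h1
      rw [sub_eq_iff_eq_add]
      exact h1.symm
    by_cases hnm : n = m
    · rw [hnm]
    · ext g
      have h1 := key n m g
      have h2 := key m n g
      have h3 : (c n - c m) • (R n (R m g) - R m (R n g)) = 0 := by
        have h4 : (c n - c m) • R m (R n g) = -(R n g - R m g) := by
          rw [h2, ← neg_smul, neg_sub]
        rw [smul_sub, ← h1, h4]; abel
      have hne : c n - c m ≠ 0 := by
        rw [sub_ne_zero]
        intro h
        apply hnm
        have : (n : ℝ) + 1 = m + 1 := Complex.ofReal_injective h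
        exact_mod_cast add_right_cancel this
      simpa [sub_eq_zero, hne] using h3
  refine ⟨fun n => c n • (c n • R n - 1), ?_, ?_, ?_⟩
  · intro n f
    have h1 : (⟪f, c n • R n f⟫_ℂ).re ≤ ‖f‖ * ‖f‖ :=
      ((Complex.re_le_norm _).trans (norm_inner_le_norm _ _)).trans
        (mul_le_mul_of_nonneg_left (hJ n f) (norm_nonneg _))
    have h2 : (⟪f, f⟫_ℂ) = ((‖f‖ ^ 2 : ℝ) : ℂ) := by
      rw [inner_self_eq_norm_sq_to_K]; norm_cast
    have h3 : (c n • (c n • R n - 1)) f = c n • (c n • R n f - f) := rfl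
    rw [h3, inner_smul_right, inner_sub_right, h2, hc, Complex.re_ofReal_mul, Complex.sub_re,
      Complex.ofReal_re]
    have : (⟪f, c n • R n f⟫_ℂ).re - ‖f‖ ^ 2 ≤ 0 := by nlinarith
    exact mul_nonpos_of_nonneg_of_nonpos (hpos n).le this
  · intro n m
    refine Commute.smul_left (Commute.smul_right ?_ _) _
    refine Commute.sub_left (Commute.sub_right ?_ (Commute.one_right _)) (Commute.one_left _)
    exact ((hcomm n m).smul_right _).smul_left _
  · have hJlim : ∀ g, Tendsto (fun n => c n • R n g) atTop (𝓝 g) := by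
      have hsub : ∀ n, ∀ q ∈ A, c n • R n q.1 - q.1 = R n q.2 := by
        intro n q hq
        have := hR2 n q hq
        rw [map_sub, map_smul] at this
        rw [sub_eq_iff_eq_add]
        rw [sub_eq_iff_eq_add] at this
        rw [add_comm]; exact this
      intro g
      rw [Metric.tendsto_atTop]
      intro ε hε
      obtain ⟨f, hfg, f', hf⟩ := Metric.dense_iff.1 hA.dense_domain g (ε / 3) (by positivity)
      obtain ⟨N, hN⟩ := exists_nat_gt (‖f'‖ / (ε / 3))
      refine ⟨N, fun n hn => ?_⟩
      rw [mem_ball_iff_norm] at hfg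
      have h1 : c n • R n g - g = (c n • R n f - f) - c n • R n (f - g) + (f - g) := by
        rw [map_sub, smul_sub]; abel
      have h2 : ‖c n • R n f - f‖ < ε / 3 := by
        have h5 : c n • R n f - f = R n f' := hsub n _ hf
        rw [h5]
        refine (hR3 n _).trans_lt ?_
        rw [inv_mul_eq_div, div_lt_iff₀ (hpos n)]
        rw [div_lt_iff₀ (by positivity)] at hN
        have : (N : ℝ) ≤ n := by exact_mod_cast hn
        nlinarith
      rw [dist_eq_norm, h1]
      calc _ ≤ ‖c n • R n f - f‖ + ‖c n • R n (f - g)‖ + ‖f - g‖ :=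
            (norm_add_le _ _).trans (add_le_add_left (norm_sub_le _ _) _)
        _ < ε := by linarith [hJ n (f - g)]
    intro q hq
    refine (hJlim q.2).congr fun n => ?_
    have := hR2 n q hq
    rw [map_sub, map_smul] at this
    change c n • R n q.2 = c n • (c n • R n q.1 - q.1)
    congr 1
    nth_rewrite 2 [← this]
    simp only [hc]; abel

/-- The Lumer–Phillips theorem: a maximal dissipative operator generates a semigroup. -/
theorem exists_isSemigroupGeneratedBy [CompleteSpace X] :
    ∃ S : ℝ → X →L[ℂ] X, IsSemigroupGeneratedBy S (A : Set (X × X)) := by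
  obtain ⟨B, hB, hBc, hBA⟩ := hA.exists_yosida
  have hcontr : ∀ n (t : ℝ), 0 ≤ t → ∀ f, ‖expSemigroup (B n) t f‖ ≤ ‖f‖ := fun n t ht f =>
    norm_expSemigroup_apply_le (hB n) f ht
  have hcauchy : ∀ t : ℝ, 0 ≤ t → ∀ f, CauchySeq fun n => expSemigroup (B n) t f := by
    intro t ht f
    rw [Metric.cauchySeq_iff]
    intro ε hε
    obtain ⟨f₁, hf₁, f₂, hf₂⟩ := Metric.dense_iff.1 hA.dense_domain f (ε / 3) (by positivity)
    rw [mem_ball_iff_norm] at hf₁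
    obtain ⟨N, hN⟩ := Metric.cauchySeq_iff.1 (hBA _ hf₂).cauchySeq (ε / 3 / (t + 1))
      (by positivity)
    refine ⟨N, fun m hm n hn => ?_⟩
    have h1 := hN m hm n hn
    rw [dist_eq_norm, lt_div_iff₀ (by positivity)] at h1
    have h2 := norm_expSemigroup_sub_le (hB m) (hB n) (hBc m n) f₁ ht
    have h3 : expSemigroup (B m) t f - expSemigroup (B n) t f =
        (expSemigroup (B m) t f₁ - expSemigroup (B n) t f₁) - expSemigroup (B m) t (f₁ - f)
          + expSemigroup (B n) t (f₁ - f) := by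
      rw [map_sub, map_sub]; abel
    rw [dist_eq_norm, h3]
    have h4 := hcontr m t ht (f₁ - f)
    have h5 := hcontr n t ht (f₁ - f)
    have h6 : t * ‖B m f₁ - B n f₁‖ ≤ ‖B m f₁ - B n f₁‖ * (t + 1) := by
      nlinarith [norm_nonneg (B m f₁ - B n f₁)]
    calc _ ≤ ‖expSemigroup (B m) t f₁ - expSemigroup (B n) t f₁‖ + ‖expSemigroup (B m) t (f₁ - f)‖
          + ‖expSemigroup (B n) t (f₁ - f)‖ :=
            (norm_add_le _ _).trans (add_le_add_left (norm_sub_le _ _) _)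
      _ < ε := by linarith
  -- Convergence is known only for nonnegative times, hence the truncation `max t 0`; negative times
  -- play no role.
  choose s hs using fun (t : ℝ) (f : X) =>
    cauchySeq_tendsto_of_complete (hcauchy (max t 0) (le_max_right _ _) f)
  have hlim : ∀ t, 0 ≤ t → ∀ f, Tendsto (fun n => expSemigroup (B n) t f) atTop (𝓝 (s t f)) := by
    intro t ht f
    have := hs t f
    rwa [max_eq_left ht] at this
  set S : ℝ → X →L[ℂ] X := fun t => continuousLinearMapOfTendsto
    (fun n => expSemigroup (B n) (max t 0)) (f := s t) (tendsto_pi_nhds.2 (hs t)) with hS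
  have hSlim : ∀ t, 0 ≤ t → ∀ f, Tendsto (fun n => expSemigroup (B n) t f) atTop (𝓝 (S t f)) :=
    hlim
  have hScontr : ∀ t, 0 ≤ t → ∀ f, ‖S t f‖ ≤ ‖f‖ := fun t ht f =>
    le_of_tendsto (hSlim t ht f).norm (Eventually.of_forall fun n => hcontr n t ht f)
  have hSadd : ∀ a b : ℝ, 0 ≤ a → 0 ≤ b → S (a + b) = (S a).comp (S b) := by
    intro a b ha hb
    ext f
    refine tendsto_nhds_unique (hSlim _ (add_nonneg ha hb) f) ?_
    have h1 : Tendsto (fun n => expSemigroup (B n) a (S b f)) atTop (𝓝 (S a (S b f))) :=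
      hSlim a ha _
    have h2 : Tendsto (fun n => expSemigroup (B n) a (expSemigroup (B n) b f - S b f)) atTop
        (𝓝 0) := by
      rw [tendsto_zero_iff_norm_tendsto_zero]
      refine squeeze_zero (fun _ => norm_nonneg _) (fun n => hcontr n a ha _) ?_
      have := (hSlim b hb f).sub_const (S b f)
      rw [sub_self] at this
      simpa using this.norm
    have h3 := h2.add h1
    rw [zero_add] at h3
    refine h3.congr fun n => ?_
    rw [map_sub, sub_add_cancel, expSemigroup_add]
    rfl
  have hSzero : S 0 = ContinuousLinearMap.id ℂ X := by
    ext f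
    refine tendsto_nhds_unique (hSlim 0 le_rfl f) ?_
    simp [expSemigroup_zero]
  have hSlip : ∀ q ∈ A, ∀ t, 0 ≤ t → ‖S t q.1 - q.1‖ ≤ t * ‖q.2‖ := by
    intro q hq t ht
    refine le_of_tendsto_of_tendsto ((hSlim t ht q.1).sub_const q.1).norm
      ((hBA q hq).norm.const_mul t) (Eventually.of_forall fun n => ?_)
    exact norm_expSemigroup_sub_self_le (hB n) q.1 ht
  have hSright : ∀ f, Tendsto (fun t => ‖S t f - f‖) (𝓝[≥] 0) (𝓝 0) := by
    intro f
    rw [Metric.tendsto_nhds]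
    intro ε hε
    obtain ⟨f₁, hf₁, f₂, hf₂⟩ := Metric.dense_iff.1 hA.dense_domain f (ε / 3) (by positivity)
    rw [mem_ball_iff_norm] at hf₁
    have hev : ∀ᶠ t : ℝ in 𝓝[≥] 0, t < ε / 3 / (‖f₂‖ + 1) :=
      nhdsWithin_le_nhds (gt_mem_nhds (by positivity))
    filter_upwards [hev, self_mem_nhdsWithin] with t ht ht0
    rw [lt_div_iff₀ (by positivity)] at ht
    rw [dist_zero_right, norm_norm]
    have h1 := hSlip _ hf₂ t ht0
    have h2 := hScontr t ht0 (f₁ - f)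
    have h3 : S t f - f = (S t f₁ - f₁) - S t (f₁ - f) + (f₁ - f) := by
      rw [map_sub]; abel
    rw [h3]
    have h4 : t * ‖f₂‖ ≤ t * (‖f₂‖ + 1) := mul_le_mul_of_nonneg_left (by linarith) ht0
    calc _ ≤ ‖S t f₁ - f₁‖ + ‖S t (f₁ - f)‖ + ‖f₁ - f‖ :=
            (norm_add_le _ _).trans (add_le_add_left (norm_sub_le _ _) _)
      _ < ε := by simp only at h1; linarith
  have hScont : ∀ f, ContinuousOn (fun t => S t f) (Ici 0) := by
    intro f t ht
    have hdiff : ∀ a b : ℝ, 0 ≤ a → a ≤ b → ‖S b f - S a f‖ ≤ ‖S (b - a) f - f‖ := by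
      intro a b ha hab
      have h1 : S b f = S a (S (b - a) f) := by
        have := hSadd a (b - a) ha (sub_nonneg.2 hab)
        rw [add_sub_cancel] at this
        rw [this]; rfl
      rw [h1, ← map_sub]
      exact hScontr a ha _
    have hbound : ∀ r ∈ Ici (0 : ℝ), ‖S r f - S t f‖ ≤ ‖S |r - t| f - f‖ := by
      intro r hr
      rcases le_total t r with h | h
      · rw [abs_of_nonneg (sub_nonneg.2 h)]; exact hdiff t r ht h
      · rw [abs_of_nonpos (sub_nonpos.2 h), neg_sub, norm_sub_rev]; exact hdiff r t hr h
    rw [ContinuousWithinAt, tendsto_iff_norm_sub_tendsto_zero]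
    refine squeeze_zero' (Eventually.of_forall fun _ => norm_nonneg _)
      (eventually_mem_nhdsWithin.mono hbound) ?_
    refine (hSright f).comp (tendsto_nhdsWithin_iff.2 ⟨?_, Eventually.of_forall fun r =>
      mem_Ici.2 (abs_nonneg _)⟩)
    have : Tendsto (fun r => |r - t|) (𝓝 t) (𝓝 |t - t|) :=
      (by fun_prop : Continuous fun r : ℝ => |r - t|).tendsto t
    rw [sub_self, abs_zero] at this
    exact this.mono_left nhdsWithin_le_nhds
  have hSgen : ∀ q ∈ A,
      Tendsto (fun h : ℝ => ((h⁻¹ : ℝ) : ℂ) • (S h q.1 - q.1)) (𝓝[>] 0) (𝓝 q.2) := by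
    intro q hq
    -- `q.2` need not lie in the domain, so continuity of its orbit is made quantitative by
    -- comparison with a nearby domain element `p.1`, at the cost of `2 * ‖q.2 - p.1‖`.
    have hest : ∀ p ∈ A, ∀ h : ℝ, 0 < h →
        ‖((h⁻¹ : ℝ) : ℂ) • (S h q.1 - q.1) - q.2‖ ≤ 2 * ‖q.2 - p.1‖ + h * ‖p.2‖ := by
      intro p hp h hh
      have hn : ∀ n, ‖expSemigroup (B n) h q.1 - q.1 - h • q.2‖ ≤
          (‖B n q.1 - q.2‖ + 2 * ‖q.2 - p.1‖ + h * ‖B n p.1‖) * h := by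
        intro n
        have hd : ∀ t, HasDerivAt (fun t => expSemigroup (B n) t q.1 - t • q.2)
            (B n (expSemigroup (B n) t q.1) - q.2) t := by
          intro t
          have h1 := (hasDerivAt_id t).smul_const q.2
          rw [one_smul] at h1
          exact (hasDerivAt_expSemigroup (B n) q.1 t).sub h1
        have := norm_image_sub_le_of_norm_deriv_le_segment' (a := 0) (b := h)
          (C := ‖B n q.1 - q.2‖ + 2 * ‖q.2 - p.1‖ + h * ‖B n p.1‖)
          (fun t _ => (hd t).hasDerivWithinAt) (fun t ht => by
            have e1 : B n (expSemigroup (B n) t q.1) = expSemigroup (B n) t (B n q.1) :=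
              congrArg (fun T : X →L[ℂ] X => T q.1) (commute_expSemigroup (Commute.refl (B n)) t).eq
            have e2 : expSemigroup (B n) t (B n q.1) - q.2 =
                expSemigroup (B n) t (B n q.1 - q.2) + expSemigroup (B n) t (q.2 - p.1) +
                (expSemigroup (B n) t p.1 - p.1) + (p.1 - q.2) := by
              rw [map_sub, map_sub]; abel
            rw [e1, e2]
            have i1 := hcontr n t ht.1 (B n q.1 - q.2)
            have i2 := hcontr n t ht.1 (q.2 - p.1)
            have i3 := norm_expSemigroup_sub_self_le (hB n) p.1 ht.1
            have i4 : t * ‖B n p.1‖ ≤ h * ‖B n p.1‖ :=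
              mul_le_mul_of_nonneg_right ht.2.le (norm_nonneg _)
            have i5 := norm_sub_rev p.1 q.2
            refine (norm_add_le _ _).trans ?_
            refine (add_le_add_left (norm_add_le _ _) _).trans ?_
            refine (add_le_add_left (add_le_add_left (norm_add_le _ _) _) _).trans ?_
            linarith) h ⟨hh.le, le_rfl⟩
        rw [sub_zero, zero_smul, sub_zero, expSemigroup_zero] at this
        refine le_trans (le_of_eq ?_) this
        congr 1
        change _ = expSemigroup (B n) h q.1 - h • q.2 - q.1
        abel
      have hl : ‖S h q.1 - q.1 - h • q.2‖ ≤
          (‖q.2 - q.2‖ + 2 * ‖q.2 - p.1‖ + h * ‖p.2‖) * h :=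
        le_of_tendsto_of_tendsto (((hSlim h hh.le q.1).sub_const _).sub_const _).norm
          (((((hBA q hq).sub_const _).norm.add_const _).add ((hBA p hp).norm.const_mul h)).mul_const h)
          (Eventually.of_forall hn)
      have e : ((h⁻¹ : ℝ) : ℂ) • (S h q.1 - q.1) - q.2 =
          ((h⁻¹ : ℝ) : ℂ) • (S h q.1 - q.1 - h • q.2) := by
        have hhc : (h : ℂ) ≠ 0 := by exact_mod_cast hh.ne'
        rw [smul_sub _ _ (h • q.2), ← Complex.coe_smul h q.2, smul_smul, Complex.ofReal_inv,
          inv_mul_cancel₀ hhc, one_smul]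
      rw [e, norm_smul, Complex.norm_real, Real.norm_eq_abs, abs_of_pos (inv_pos.2 hh),
        inv_mul_eq_div, div_le_iff₀ hh]
      simpa using hl
    rw [tendsto_iff_norm_sub_tendsto_zero, Metric.tendsto_nhds]
    intro ε hε
    obtain ⟨p₁, hp₁, p₂, hp₂⟩ := Metric.dense_iff.1 hA.dense_domain q.2 (ε / 3) (by positivity)
    rw [mem_ball_iff_norm, norm_sub_rev] at hp₁
    have hev : ∀ᶠ t : ℝ in 𝓝[>] 0, t < ε / 3 / (‖p₂‖ + 1) :=
      nhdsWithin_le_nhds (gt_mem_nhds (by positivity))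
    filter_upwards [hev, self_mem_nhdsWithin] with t ht ht0
    rw [lt_div_iff₀ (by positivity)] at ht
    rw [dist_zero_right, norm_norm]
    have h1 := hest _ hp₂ t ht0
    have ht0' : (0 : ℝ) < t := ht0
    simp only at h1
    nlinarith
  refine ⟨S, hSzero, hSadd, hScont, fun f g => ⟨fun hfg => ?_, fun hq => hSgen _ hq⟩⟩
  -- Maximality: the true generator is dissipative and extends A. The difference of (f, g) and q has
  -- equal components, hence vanishes.
  obtain ⟨q, hq, hqe⟩ := hA.exists_resolvent 1 one_pos (f - g)
  have hlimd : Tendsto (fun h : ℝ => ((h⁻¹ : ℝ) : ℂ) • (S h (f - q.1) - (f - q.1))) (𝓝[>] 0)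
      (𝓝 (g - q.2)) := by
    refine (hfg.sub (hSgen q hq)).congr fun h => ?_
    rw [← smul_sub, map_sub]; congr 1; abel
  have hdiss : (⟪f - q.1, g - q.2⟫_ℂ).re ≤ 0 := by
    refine le_of_tendsto (Complex.continuous_re.continuousAt.tendsto.comp
      ((tendsto_const_nhds (x := f - q.1)).inner hlimd)) ?_
    filter_upwards [self_mem_nhdsWithin] with h hh
    have hh' : (0 : ℝ) < h := hh
    have h1 : (⟪f - q.1, S h (f - q.1)⟫_ℂ).re ≤ ‖f - q.1‖ * ‖f - q.1‖ :=
      ((Complex.re_le_norm _).trans (norm_inner_le_norm _ _)).trans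
        (mul_le_mul_of_nonneg_left (hScontr h hh'.le _) (norm_nonneg _))
    have h2 : (⟪f - q.1, f - q.1⟫_ℂ) = ((‖f - q.1‖ ^ 2 : ℝ) : ℂ) := by
      rw [inner_self_eq_norm_sq_to_K]; norm_cast
    rw [Function.comp_apply, inner_smul_right, inner_sub_right, h2, Complex.re_ofReal_mul,
      Complex.sub_re, Complex.ofReal_re]
    exact mul_nonpos_of_nonneg_of_nonpos (inv_pos.2 hh').le (by nlinarith)
  have he : g - q.2 = f - q.1 := by
    rw [Complex.ofReal_one, one_smul] at hqe
    rw [sub_eq_sub_iff_sub_eq_sub, ← neg_sub f g, ← hqe, neg_sub]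
  rw [he, inner_self_eq_norm_sq_to_K] at hdiss
  have h0 : ‖f - q.1‖ ^ 2 ≤ 0 := by
    have : (((‖f - q.1‖ : ℝ) : ℂ) ^ 2).re = ‖f - q.1‖ ^ 2 := by norm_cast
    rw [← this]; exact hdiss
  have h1 : f - q.1 = 0 := by
    rw [← norm_eq_zero]
    exact pow_eq_zero_iff two_ne_zero |>.1 (le_antisymm h0 (sq_nonneg _))
  rw [h1] at he
  have : (f, g) = q := Prod.ext (sub_eq_zero.1 h1) (sub_eq_zero.1 he)
  rw [this]
  exact hq

end IsMaxDissipative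

end LumerPhillips

/-! ### Lyapunov functionals along orbits, and invariance of a projection -/

namespace IsSemigroupGeneratedBy

section Banach

variable {X : Type*} [NormedAddCommGroup X] [NormedSpace ℂ X] {S : ℝ → X →L[ℂ] X} {A : Set (X × X)}

theorem orbit_mem (hS : IsSemigroupGeneratedBy S A) {q : X × X} (hq : q ∈ A) {t : ℝ} (ht : 0 ≤ t) :
    (S t q.1, S t q.2) ∈ A := by
  rw [← hS.generator]
  have h1 := ((S t).continuous.tendsto q.2).comp ((hS.generator q.1 q.2).2 hq)
  refine h1.congr' ?_
  filter_upwards [self_mem_nhdsWithin] with h hh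
  have hh' : (0 : ℝ) ≤ h := le_of_lt hh
  have h2 : S h (S t q.1) = S t (S h q.1) := by
    have e1 := hS.map_add h t hh' ht
    have e2 := hS.map_add t h ht hh'
    rw [add_comm, e2] at e1
    exact (congrArg (fun T : X →L[ℂ] X => T q.1) e1).symm
  rw [h2, Function.comp_apply, map_smul, map_sub]

theorem hasDerivWithinAt_orbit (hS : IsSemigroupGeneratedBy S A) {q : X × X} (hq : q ∈ A) {t : ℝ}
    (ht : 0 ≤ t) : HasDerivWithinAt (fun s => S s q.1) (S t q.2) (Ici t) t := by
  rw [hasDerivWithinAt_iff_tendsto_slope, Ici_sdiff_left]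
  have h1 := (hS.generator _ _).2 (hS.orbit_mem hq ht)
  have h2 : Tendsto (fun s : ℝ => s - t) (𝓝[>] t) (𝓝[>] 0) := by
    refine tendsto_nhdsWithin_iff.2 ⟨?_, ?_⟩
    · have : Tendsto (fun s : ℝ => s - t) (𝓝 t) (𝓝 (t - t)) :=
        (by fun_prop : Continuous fun s : ℝ => s - t).tendsto t
      rw [sub_self] at this
      exact this.mono_left nhdsWithin_le_nhds
    · filter_upwards [self_mem_nhdsWithin] with s hs
      exact sub_pos.2 (mem_Ioi.1 hs)
  refine (h1.comp h2).congr' ?_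
  filter_upwards [self_mem_nhdsWithin] with s hs
  have hs' : (0 : ℝ) ≤ s - t := (sub_pos.2 (mem_Ioi.1 hs)).le
  have h3 : S s q.1 = S (s - t) (S t q.1) := by
    have := hS.map_add (s - t) t hs' ht
    rw [sub_add_cancel] at this
    rw [this]; rfl
  rw [Function.comp_apply, slope_def_module, h3, Complex.coe_smul]

end Banach

variable {X : Type*} [NormedAddCommGroup X] [InnerProductSpace ℂ X] {S : ℝ → X →L[ℂ] X}
  {A : Set (X × X)}

/-- Exponential decay of a quadratic Lyapunov functional along the orbits of a semigroup. -/
theorem quadratic_decay (hS : IsSemigroupGeneratedBy S A) (B : X →L[ℂ] X) (c : ℝ)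
    (hB : ∀ q ∈ A, (⟪q.1, B q.2⟫_ℂ).re + (⟪q.2, B q.1⟫_ℂ).re ≤ -c * (⟪q.1, B q.1⟫_ℂ).re)
    {q : X × X} (hq : q ∈ A) {t : ℝ} (ht : 0 ≤ t) :
    (⟪S t q.1, B (S t q.1)⟫_ℂ).re ≤ (⟪q.1, B q.1⟫_ℂ).re * Real.exp (-c * t) := by
  have hd : ∀ s ∈ Ico 0 t, HasDerivWithinAt (fun s => (⟪S s q.1, B (S s q.1)⟫_ℂ).re)
      ((⟪S s q.1, B (S s q.2)⟫_ℂ).re + (⟪S s q.2, B (S s q.1)⟫_ℂ).re) (Ici s) s := by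
    intro s hs
    have h1 := hS.hasDerivWithinAt_orbit hq hs.1
    have h2 := (B.restrictScalars ℝ).hasFDerivAt.comp_hasDerivWithinAt s h1
    exact Complex.reCLM.hasFDerivAt.comp_hasDerivWithinAt s (h1.inner ℂ h2)
  have hc : ContinuousOn (fun s => (⟪S s q.1, B (S s q.1)⟫_ℂ).re) (Icc 0 t) := by
    have h1 : ContinuousOn (fun s => S s q.1) (Icc 0 t) :=
      (hS.continuousOn q.1).mono Icc_subset_Ici_self
    exact Complex.continuous_re.comp_continuousOn (h1.inner (B.continuous.comp_continuousOn h1))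
  -- Only right derivatives of the orbit are available, so Grönwall's inequality is used in its
  -- one-sided form.
  have := le_gronwallBound_of_liminf_deriv_right_le (ε := 0) (K := -c) hc
    (fun s hs r hr => ((hd s hs).liminf_right_slope_le hr).mono fun z hz => by
      rwa [slope_def_field, div_eq_inv_mul] at hz)
    (by rw [hS.map_zero]; rfl : _ ≤ (⟪q.1, B q.1⟫_ℂ).re)
    (fun s hs => by
      rw [add_zero]
      exact hB _ (hS.orbit_mem hq hs.1)) t ⟨ht, le_rfl⟩
  rwa [gronwallBound_ε0, sub_zero] at this

section Projection

variable {A : Submodule ℂ (X × X)} {P : X →L[ℂ] X}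

/-- A semigroup of contractions preserves the range of an orthogonal projection that commutes with
its generator. -/
theorem orbit_projection (hS : IsSemigroupGeneratedBy S (A : Set (X × X)))
    (hdiss : ∀ q ∈ A, (⟪q.1, q.2⟫_ℂ).re ≤ 0) (hPP : ∀ f, P (P f) = P f)
    (hPsymm : ∀ f g, ⟪P f, g⟫_ℂ = ⟪f, P g⟫_ℂ) (hPA : ∀ q ∈ A, (P q.1, P q.2) ∈ A)
    {q : X × X} (hq : q ∈ A) {t : ℝ} (ht : 0 ≤ t) : P (S t (P q.1)) = S t (P q.1) := by
  have hinn : ∀ f g : X, ⟪f, (1 - P) g⟫_ℂ = ⟪f - P f, g - P g⟫_ℂ := by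
    intro f g
    change ⟪f, g - P g⟫_ℂ = _
    rw [inner_sub_left, hPsymm, map_sub, hPP, sub_self, inner_zero_right, sub_zero]
  -- The functional ‖f - P f‖² does not increase along orbits and starts at zero.
  have h1 := hS.quadratic_decay (1 - P) 0 (fun q hq => by
    have h2 := hdiss _ (A.sub_mem hq (hPA q hq))
    have h3 : (⟪q.2 - P q.2, q.1 - P q.1⟫_ℂ).re = (⟪q.1 - P q.1, q.2 - P q.2⟫_ℂ).re :=
      inner_re_symm (𝕜 := ℂ) _ _
    rw [hinn, hinn, h3, neg_zero, zero_mul]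
    simp only [Prod.fst_sub, Prod.snd_sub] at h2
    linarith) (hPA q hq) ht
  simp only [hinn, hPP, sub_self, inner_zero_left, Complex.zero_re, zero_mul] at h1
  have h4 : (⟪S t (P q.1) - P (S t (P q.1)), S t (P q.1) - P (S t (P q.1))⟫_ℂ).re =
      ‖S t (P q.1) - P (S t (P q.1))‖ ^ 2 := inner_self_eq_norm_sq (𝕜 := ℂ) _
  rw [h4] at h1
  have h5 := pow_eq_zero_iff two_ne_zero |>.1 (le_antisymm h1 (sq_nonneg _))
  exact (sub_eq_zero.1 (norm_eq_zero.1 h5)).symm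

/-- Exponential decay on the range of a projection, from a Lyapunov functional that is equivalent
to the norm there. -/
theorem norm_comp_projection_le (hS : IsSemigroupGeneratedBy S (A : Set (X × X)))
    (hdense : Dense {f : X | ∃ g, (f, g) ∈ A})
    (hdiss : ∀ q ∈ A, (⟪q.1, q.2⟫_ℂ).re ≤ 0) (hPP : ∀ f, P (P f) = P f)
    (hPsymm : ∀ f g, ⟪P f, g⟫_ℂ = ⟪f, P g⟫_ℂ) (hPle : ∀ f, ‖P f‖ ≤ ‖f‖)
    (hPA : ∀ q ∈ A, (P q.1, P q.2) ∈ A) {B : X →L[ℂ] X} {c : ℝ}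
    (hB : ∀ q ∈ A, (⟪q.1, B q.2⟫_ℂ).re + (⟪q.2, B q.1⟫_ℂ).re ≤ -c * (⟪q.1, B q.1⟫_ℂ).re)
    (hlow : ∀ f, 1 / 2 * ‖P f‖ ^ 2 ≤ (⟪f, B f⟫_ℂ).re)
    (hup : ∀ f, (⟪f, B f⟫_ℂ).re ≤ 3 / 2 * ‖P f‖ ^ 2) {t : ℝ} (ht : 0 ≤ t) :
    ‖(S t).comp P‖ ≤ 2 * Real.exp (-(c / 2) * t) := by
  have hdom : ∀ q ∈ A, ‖(S t).comp P q.1‖ ≤ 2 * Real.exp (-(c / 2) * t) * ‖q.1‖ := by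
    intro q hq
    have h1 := hS.quadratic_decay B c hB (hPA q hq) ht
    have h2 := hlow (S t (P q.1))
    rw [hS.orbit_projection hdiss hPP hPsymm hPA hq ht] at h2
    have h3 := hup (P q.1)
    rw [hPP] at h3
    have h5 : ‖P q.1‖ ^ 2 ≤ ‖q.1‖ ^ 2 := by
      gcongr
      exact hPle q.1
    -- The factor 3 is the ratio of the equivalence constants 3/2 and 1/2; it is below 2², whence
    -- the final constant 2.
    have h7 : ‖S t (P q.1)‖ ^ 2 ≤ 3 * ‖q.1‖ ^ 2 * Real.exp (-c * t) := by
      have h8 : (⟪P q.1, B (P q.1)⟫_ℂ).re * Real.exp (-c * t) ≤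
          (3 / 2 * ‖q.1‖ ^ 2) * Real.exp (-c * t) :=
        mul_le_mul_of_nonneg_right (by linarith) (Real.exp_pos _).le
      simp only at h1
      linarith
    refine le_of_sq_le_sq (h7.trans ?_) (by positivity)
    have h9 : Real.exp (-(c / 2) * t) ^ 2 = Real.exp (-c * t) := by
      rw [← Real.exp_nat_mul]; congr 1; push_cast; ring
    rw [mul_pow, mul_pow, h9]
    have : 0 ≤ Real.exp (-c * t) * ‖q.1‖ ^ 2 := by positivity
    linarith
  refine ContinuousLinearMap.opNorm_le_bound _ (by positivity) fun f => ?_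
  have hcl : IsClosed {f : X | ‖(S t).comp P f‖ ≤ 2 * Real.exp (-(c / 2) * t) * ‖f‖} :=
    isClosed_le ((S t).comp P).continuous.norm (continuous_norm.const_mul _)
  have hsub : {f : X | ∃ g, (f, g) ∈ A} ⊆
      {f : X | ‖(S t).comp P f‖ ≤ 2 * Real.exp (-(c / 2) * t) * ‖f‖} := by
    rintro f ⟨g, hfg⟩
    exact hdom _ hfg
  exact hcl.closure_subset_iff.2 hsub (hdense f)

end Projection

end IsSemigroupGeneratedBy

/-! ### Fourier basis of the torus and Parseval's identity -/

section Characters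

theorem integral_fourier (n : ℤ) :
    ∫ x : Circ, fourier n x = if n = 0 then ((2 * π : ℝ) : ℂ) else 0 := by
  split_ifs with h
  · have h1 : ∀ x : Circ, fourier n x = (1 : ℂ) := fun x => by rw [h]; exact fourier_zero
    simp_rw [h1]
    rw [integral_const, Measure.real, AddCircle.measure_univ, ENNReal.toReal_ofReal (by positivity)]
    simp
  · exact integral_eq_zero_of_add_right_eq_neg (fourier_add_half_inv_index h (by positivity))

theorem character_apply (j l : ℤ) (p : Torus) : character j l p = fourier j p.1 * fourier l p.2 :=
  rfl

theorem character_neg (j l : ℤ) (p : Torus) : character (-j) (-l) p = conj (character j l p) := by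
  rw [character_apply, character_apply, fourier_neg, fourier_neg, map_mul]

theorem character_add (j l j' l' : ℤ) (p : Torus) :
    character (j + j') (l + l') p = character j l p * character j' l' p := by
  simp only [character_apply, fourier_add]
  ring

theorem coeFn_characterLp (j l : ℤ) : characterLp j l =ᵐ[volume] character j l :=
  ContinuousMap.coeFn_toLp (volume : Measure Torus) (character j l)

theorem inner_characterLp (j l j' l' : ℤ) : ⟪characterLp j l, characterLp j' l'⟫_ℂ =
    if (j, l) = (j', l') then ((2 * π : ℝ) : ℂ) ^ 2 else 0 := by
  rw [characterLp, characterLp, ContinuousMap.inner_toLp]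
  have h1 : ∀ p : Torus, character j' l' p * conj (character j l p) =
      fourier (j' + -j) p.1 * fourier (l' + -l) p.2 := by
    intro p
    rw [← character_neg, ← character_add]; rfl
  simp_rw [h1]
  rw [Measure.volume_eq_prod, integral_prod_mul (fun x : Circ => fourier (j' + -j) x)
    (fun y : Circ => fourier (l' + -l) y), integral_fourier, integral_fourier]
  simp only [← sub_eq_add_neg, sub_eq_zero, Prod.mk.injEq]
  by_cases h : j = j' <;> by_cases h' : l = l' <;> simp [h, h', sq, eq_comm]

/-- The trigonometric polynomials on the torus. -/
def characterSubalgebra : StarSubalgebra ℂ C(Torus, ℂ) where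
  toSubalgebra := Algebra.adjoin ℂ (range fun a : ℤ × ℤ => character a.1 a.2)
  star_mem' := by
    change Algebra.adjoin ℂ (range fun a : ℤ × ℤ => character a.1 a.2) ≤
      star (Algebra.adjoin ℂ (range fun a : ℤ × ℤ => character a.1 a.2))
    refine Algebra.adjoin_le ?_
    rintro - ⟨a, rfl⟩
    exact Algebra.subset_adjoin ⟨-a, ContinuousMap.ext fun p => character_neg a.1 a.2 p⟩

theorem characterSubalgebra_coe :
    Subalgebra.toSubmodule characterSubalgebra.toSubalgebra =
      Submodule.span ℂ (range fun a : ℤ × ℤ => character a.1 a.2) := by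
  apply Algebra.adjoin_eq_span_of_subset
  refine Subset.trans ?_ Submodule.subset_span
  intro x hx
  refine Submonoid.closure_induction (fun _ => id) ⟨0, ?_⟩ ?_ hx
  · ext p
    simp [character_apply]
  · rintro - - - - ⟨a, rfl⟩ ⟨b, rfl⟩
    exact ⟨a + b, ContinuousMap.ext fun p => character_add a.1 a.2 b.1 b.2 p⟩

theorem characterSubalgebra_separatesPoints : characterSubalgebra.SeparatesPoints := by
  have hinj : Function.Injective fun x : Circ => (fourier 1 x : ℂ) := by
    intro x y h
    simp only [fourier_one] at h
    exact AddCircle.injective_toCircle (by positivity) (Subtype.coe_injective h)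
  intro x y hxy
  by_cases h1 : x.1 = y.1
  · have h2 : x.2 ≠ y.2 := fun h2 => hxy (Prod.ext h1 h2)
    refine ⟨_, ⟨character 0 1, Algebra.subset_adjoin ⟨(0, 1), rfl⟩, rfl⟩, ?_⟩
    simp only [character_apply, fourier_zero, one_mul]
    exact fun h => h2 (hinj h)
  · refine ⟨_, ⟨character 1 0, Algebra.subset_adjoin ⟨(1, 0), rfl⟩, rfl⟩, ?_⟩
    simp only [character_apply, fourier_zero, mul_one]
    exact fun h => h1 (hinj h)

theorem span_character_closure_eq_top :
    (Submodule.span ℂ (range fun a : ℤ × ℤ => character a.1 a.2)).topologicalClosure = ⊤ := by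
  rw [← characterSubalgebra_coe]
  exact congr_arg (Subalgebra.toSubmodule <| StarSubalgebra.toSubalgebra ·)
    (ContinuousMap.starSubalgebra_topologicalClosure_eq_top_of_separatesPoints
      characterSubalgebra characterSubalgebra_separatesPoints)

theorem span_characterLp_closure_eq_top :
    (Submodule.span ℂ (range fun a : ℤ × ℤ => characterLp a.1 a.2)).topologicalClosure = ⊤ := by
  convert! (ContinuousMap.toLp_denseRange ℂ (volume : Measure Torus) ℂ
    (by simp : (2 : ℝ≥0∞) ≠ ∞)).topologicalClosure_map_submodule span_character_closure_eq_top
  rw [Submodule.map_span, ← range_comp]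
  rfl

theorem orthonormal_character :
    Orthonormal ℂ fun a : ℤ × ℤ => (((2 * π)⁻¹ : ℝ) : ℂ) • characterLp a.1 a.2 := by
  rw [orthonormal_iff_ite]
  intro a b
  rw [inner_smul_left, inner_smul_right, inner_characterLp, Complex.conj_ofReal]
  have : (π : ℂ) ≠ 0 := by exact_mod_cast pi_ne_zero
  split_ifs with h
  · push_cast; field_simp
  · simp

/-- The Fourier basis of `L²(𝕋²)`. -/
def torusBasis : HilbertBasis (ℤ × ℤ) ℂ L2Torus :=
  HilbertBasis.mk orthonormal_character (by
    rw [← span_characterLp_closure_eq_top]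
    refine Submodule.topologicalClosure_mono (Submodule.span_le.2 ?_)
    rintro - ⟨a, rfl⟩
    have h1 := Submodule.smul_mem _ (((2 * π : ℝ)) : ℂ) (Submodule.subset_span (R := ℂ)
      (mem_range_self (f := fun a : ℤ × ℤ => (((2 * π)⁻¹ : ℝ) : ℂ) • characterLp a.1 a.2) a))
    have : (π : ℂ) ≠ 0 := by exact_mod_cast pi_ne_zero
    rw [smul_smul, ← Complex.ofReal_mul, mul_inv_cancel₀ (by positivity), Complex.ofReal_one,
      one_smul] at h1
    exact h1)

/-- The (unnormalised) Fourier coefficient of a function on the torus. -/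
def coef (f : L2Torus) (j l : ℤ) : ℂ := ⟪characterLp j l, f⟫_ℂ

theorem coef_eq_integral (f : L2Torus) (j l : ℤ) :
    coef f j l = ∫ p : Torus, f p * character (-j) (-l) p := by
  rw [coef, L2.inner_def]
  refine integral_congr_ae ?_
  filter_upwards [coeFn_characterLp j l] with p hp
  rw [hp, character_neg]
  simp

theorem coef_add (f g : L2Torus) (j l : ℤ) : coef (f + g) j l = coef f j l + coef g j l :=
  inner_add_right _ _ _

theorem coef_sub (f g : L2Torus) (j l : ℤ) : coef (f - g) j l = coef f j l - coef g j l :=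
  inner_sub_right _ _ _

theorem coef_smul (c : ℂ) (f : L2Torus) (j l : ℤ) : coef (c • f) j l = c * coef f j l :=
  inner_smul_right _ _ _

theorem continuous_coef (j l : ℤ) : Continuous fun f : L2Torus => coef f j l :=
  continuous_const.inner continuous_id

theorem torusBasis_apply (a : ℤ × ℤ) :
    torusBasis a = (((2 * π)⁻¹ : ℝ) : ℂ) • characterLp a.1 a.2 := by
  rw [torusBasis, HilbertBasis.coe_mk]

theorem inner_torusBasis (a : ℤ × ℤ) (f : L2Torus) :
    ⟪torusBasis a, f⟫_ℂ = (((2 * π)⁻¹ : ℝ) : ℂ) * coef f a.1 a.2 := by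
  rw [torusBasis_apply, inner_smul_left, Complex.conj_ofReal, coef]

theorem coef_ext {f g : L2Torus} (h : ∀ j l, coef f j l = coef g j l) : f = g := by
  apply torusBasis.repr.injective
  ext a
  rw [HilbertBasis.repr_apply_apply, HilbertBasis.repr_apply_apply, inner_torusBasis,
    inner_torusBasis, h]

theorem hasSum_coef (f g : L2Torus) :
    HasSum (fun a : ℤ × ℤ => conj (coef f a.1 a.2) * coef g a.1 a.2)
      (((2 * π : ℝ) : ℂ) ^ 2 * ⟪f, g⟫_ℂ) := by
  have h := (torusBasis.hasSum_inner_mul_inner f g).mul_left (((2 * π : ℝ) : ℂ) ^ 2)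
  refine h.congr_fun fun a => ?_
  have : (π : ℂ) ≠ 0 := by exact_mod_cast pi_ne_zero
  rw [← inner_conj_symm f, inner_torusBasis, inner_torusBasis, map_mul, Complex.conj_ofReal]
  push_cast
  field_simp

theorem hasSum_norm_coef_sq (f : L2Torus) :
    HasSum (fun a : ℤ × ℤ => ‖coef f a.1 a.2‖ ^ 2) ((2 * π) ^ 2 * ‖f‖ ^ 2) := by
  have h := hasSum_coef f f
  rw [inner_self_eq_norm_sq_to_K] at h
  have h2 := Complex.hasSum_re h
  convert h2 using 1
  · ext a
    rw [← Complex.normSq_eq_conj_mul_self, Complex.ofReal_re, Complex.normSq_eq_norm_sq]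
  · have : ((((2 * π) ^ 2 * ‖f‖ ^ 2 : ℝ)) : ℂ) = ((2 * π : ℝ) : ℂ) ^ 2 * ((‖f‖ : ℝ) : ℂ) ^ 2 := by
      push_cast; ring
    exact congrArg Complex.re this

theorem exists_coef_eq {c : ℤ × ℤ → ℂ} (hc : Summable fun a => ‖c a‖ ^ 2) :
    ∃ f : L2Torus, ∀ j l, coef f j l = c (j, l) := by
  have hm : Memℓp c 2 := memℓp_gen (by simpa using hc)
  refine ⟨(((2 * π)⁻¹ : ℝ) : ℂ) • torusBasis.repr.symm ⟨c, hm⟩, fun j l => ?_⟩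
  have h1 := inner_torusBasis (j, l) (torusBasis.repr.symm ⟨c, hm⟩)
  rw [← HilbertBasis.repr_apply_apply, LinearIsometryEquiv.apply_symm_apply] at h1
  have h2 : c (j, l) = (((2 * π)⁻¹ : ℝ) : ℂ) * coef (torusBasis.repr.symm ⟨c, hm⟩) j l := h1
  rw [coef_smul, h2]

theorem coef_characterLp (j l j' l' : ℤ) : coef (characterLp j l) j' l' =
    if (j', l') = (j, l) then ((2 * π : ℝ) : ℂ) ^ 2 else 0 :=
  inner_characterLp _ _ _ _

theorem modeProj_characterLp (k j l : ℤ) :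
    modeProj k (characterLp j l) = if j = k then characterLp j l else 0 := by
  split_ifs with h
  · rw [modeProj, Submodule.starProjection_eq_self_iff, modeSubspace, h]
    exact Submodule.le_topologicalClosure _ (Submodule.subset_span (mem_range_self l))
  · rw [modeProj, Submodule.starProjection_apply_eq_zero_iff, modeSubspace,
      Submodule.orthogonal_closure, Submodule.mem_orthogonal]
    intro g hg
    induction hg using Submodule.span_induction with
    | mem x hx =>
      obtain ⟨l', rfl⟩ := hx
      rw [inner_characterLp, if_neg]
      intro h'
      exact h (Prod.ext_iff.1 h').1.symm
    | zero => simp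
    | add x y _ _ hx hy => rw [inner_add_left, hx, hy, add_zero]
    | smul c x _ hx => rw [inner_smul_left, hx, mul_zero]

theorem inner_modeProj (k : ℤ) (f g : L2Torus) :
    ⟪modeProj k f, g⟫_ℂ = ⟪f, modeProj k g⟫_ℂ :=
  Submodule.inner_starProjection_left_eq_right _ _ _

theorem coef_modeProj (k : ℤ) (f : L2Torus) (j l : ℤ) :
    coef (modeProj k f) j l = if j = k then coef f j l else 0 := by
  rw [coef, ← inner_modeProj, modeProj_characterLp]
  split_ifs
  · rfl
  · exact inner_zero_left _

end Characters

/-! ### Multiplication by functions of y -/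

section Multiplication

theorem memLp_yMul (w : C(Circ, ℂ)) (f : L2Torus) :
    MemLp (fun p : Torus => w p.2 * f p) 2 volume := by
  refine (Lp.memLp f).of_le_mul (c := ‖w‖) ?_ (Eventually.of_forall fun p => ?_)
  · exact ((w.continuous.comp continuous_snd).aestronglyMeasurable).mul (Lp.aestronglyMeasurable f)
  · rw [norm_mul]
    exact mul_le_mul_of_nonneg_right (w.norm_coe_le_norm _) (norm_nonneg _)

/-- Multiplication by a continuous function of `y`, as an operator on `L²(𝕋²)`. -/
def yMul (w : C(Circ, ℂ)) : L2Torus →L[ℂ] L2Torus :=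
  LinearMap.mkContinuous
    { toFun := fun f => (memLp_yMul w f).toLp _
      map_add' := fun f g => by
        rw [← MemLp.toLp_add]
        refine MemLp.toLp_congr _ _ ?_
        filter_upwards [Lp.coeFn_add f g] with p hp
        rw [hp, Pi.add_apply, Pi.add_apply, mul_add]
      map_smul' := fun c f => by
        rw [RingHom.id_apply, ← MemLp.toLp_const_smul]
        refine MemLp.toLp_congr _ _ ?_
        filter_upwards [Lp.coeFn_smul c f] with p hp
        rw [hp, Pi.smul_apply, Pi.smul_apply, smul_eq_mul, smul_eq_mul]
        ring } ‖w‖ (fun f => by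
      refine Lp.norm_le_mul_norm_of_ae_le_mul ?_
      filter_upwards [(memLp_yMul w f).coeFn_toLp] with p hp
      change ‖(memLp_yMul w f).toLp _ p‖ ≤ _
      rw [hp, norm_mul]
      exact mul_le_mul_of_nonneg_right (w.norm_coe_le_norm _) (norm_nonneg _))

theorem coeFn_yMul (w : C(Circ, ℂ)) (f : L2Torus) : yMul w f =ᵐ[volume] fun p => w p.2 * f p :=
  (memLp_yMul w f).coeFn_toLp

theorem norm_yMul_apply_le {w : C(Circ, ℂ)} {d : ℝ} (hd : ∀ y, ‖w y‖ ≤ d) (f : L2Torus) :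
    ‖yMul w f‖ ≤ d * ‖f‖ := by
  refine Lp.norm_le_mul_norm_of_ae_le_mul ?_
  filter_upwards [coeFn_yMul w f] with p hp
  rw [hp, norm_mul]
  exact mul_le_mul_of_nonneg_right (hd _) (norm_nonneg _)

theorem yMul_add (w w' : C(Circ, ℂ)) (f : L2Torus) : yMul (w + w') f = yMul w f + yMul w' f := by
  refine Lp.ext ?_
  filter_upwards [coeFn_yMul w f, coeFn_yMul w' f, coeFn_yMul (w + w') f,
    Lp.coeFn_add (yMul w f) (yMul w' f)] with p h1 h2 h3 h4
  rw [h3, h4, Pi.add_apply, h1, h2, ContinuousMap.add_apply, add_mul]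

theorem yMul_smul (c : ℂ) (w : C(Circ, ℂ)) (f : L2Torus) : yMul (c • w) f = c • yMul w f := by
  refine Lp.ext ?_
  filter_upwards [coeFn_yMul w f, coeFn_yMul (c • w) f, Lp.coeFn_smul c (yMul w f)] with p h1 h2 h3
  rw [h2, h3, Pi.smul_apply, h1, ContinuousMap.smul_apply, smul_eq_mul, smul_eq_mul, mul_assoc]

theorem yMul_yMul (w w' : C(Circ, ℂ)) (f : L2Torus) : yMul w (yMul w' f) = yMul (w * w') f := by
  refine Lp.ext ?_
  filter_upwards [coeFn_yMul w (yMul w' f), coeFn_yMul w' f, coeFn_yMul (w * w') f] with p h1 h2 h3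
  rw [h1, h2, h3, ContinuousMap.mul_apply, mul_assoc]

theorem inner_yMul_left (w : C(Circ, ℂ)) (f g : L2Torus) :
    ⟪yMul w f, g⟫_ℂ = ⟪f, yMul (star w) g⟫_ℂ := by
  rw [L2.inner_def, L2.inner_def]
  refine integral_congr_ae ?_
  filter_upwards [coeFn_yMul w f, coeFn_yMul (star w) g] with p h1 h2
  rw [h1, h2]
  simp only [RCLike.inner_apply, map_mul, ContinuousMap.star_apply, RCLike.star_def]
  ring

/-- `yMul` as a bounded linear map. -/
def yMulL : C(Circ, ℂ) →L[ℂ] L2Torus →L[ℂ] L2Torus :=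
  LinearMap.mkContinuous
    { toFun := yMul
      map_add' := fun w w' => ContinuousLinearMap.ext fun f => yMul_add w w' f
      map_smul' := fun c w => ContinuousLinearMap.ext fun f => yMul_smul c w f } 1 (fun w => by
      rw [one_mul]
      exact ContinuousLinearMap.opNorm_le_bound _ (norm_nonneg _) fun f =>
        norm_yMul_apply_le w.norm_coe_le_norm f)

theorem yMulL_apply (w : C(Circ, ℂ)) : yMulL w = yMul w := rfl

theorem coef_yMul_fourier (m : ℤ) (f : L2Torus) (j l : ℤ) :
    coef (yMul (fourier m) f) j l = coef f j (l - m) := by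
  rw [coef_eq_integral, coef_eq_integral]
  refine integral_congr_ae ?_
  filter_upwards [coeFn_yMul (fourier m) f] with p hp
  rw [hp]
  have : character (-j) (-(l - m)) p = fourier m p.2 * character (-j) (-l) p := by
    rw [character_apply, character_apply, show -(l - m) = m + -l by ring, fourier_add]
    ring
  rw [this]
  ring

/-- For an exponential this is read off the Fourier coefficients; both sides are linear and
continuous in w, and trigonometric polynomials are dense. -/
theorem modeProj_yMul (k : ℤ) (w : C(Circ, ℂ)) (f : L2Torus) :
    modeProj k (yMul w f) = yMul w (modeProj k f) := by
  set K : Submodule ℂ C(Circ, ℂ) :=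
    LinearMap.ker (((modeProj k).comp ((ContinuousLinearMap.apply ℂ L2Torus f).comp yMulL) -
      (ContinuousLinearMap.apply ℂ L2Torus (modeProj k f)).comp yMulL :
        C(Circ, ℂ) →L[ℂ] L2Torus) : C(Circ, ℂ) →ₗ[ℂ] L2Torus) with hK
  have hmem : ∀ w, w ∈ K ↔ modeProj k (yMul w f) = yMul w (modeProj k f) := fun w => by
    rw [← sub_eq_zero]; rfl
  have hcl : IsClosed (K : Set C(Circ, ℂ)) := ContinuousLinearMap.isClosed_ker _
  have hle : Submodule.span ℂ (range (fourier (T := 2 * π))) ≤ K := by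
    rw [Submodule.span_le]
    rintro - ⟨m, rfl⟩
    rw [SetLike.mem_coe, hmem]
    refine coef_ext fun j l => ?_
    rw [coef_modeProj, coef_yMul_fourier, coef_yMul_fourier, coef_modeProj]
  have := Submodule.topologicalClosure_minimal _ hle hcl
  rw [span_fourier_closure_eq_top] at this
  exact (hmem w).1 (this Submodule.mem_top)

end Multiplication

/-! ### Translations in y -/

section Translation

theorem measurePreserving_yTranslate (s : Circ) :
    MeasurePreserving (fun p : Torus => (p.1, p.2 + s)) volume volume :=
  (MeasurePreserving.id (volume : Measure Circ)).prod
    (measurePreserving_add_right (volume : Measure Circ) s)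

/-- Translation in `y`: `(x, y) ↦ f (x, y + s)`. -/
def yShift (s : Circ) : L2Torus →ₗᵢ[ℂ] L2Torus :=
  Lp.compMeasurePreservingₗᵢ ℂ _ (measurePreserving_yTranslate s)

theorem coeFn_yShift (s : Circ) (f : L2Torus) :
    yShift s f =ᵐ[volume] fun p => f (p.1, p.2 + s) :=
  Lp.coeFn_compMeasurePreserving f (measurePreserving_yTranslate s)

theorem yShift_yShift (s t : Circ) (f : L2Torus) : yShift s (yShift t f) = yShift (s + t) f := by
  refine Lp.ext ?_
  have h := (measurePreserving_yTranslate s).quasiMeasurePreserving.ae (coeFn_yShift t f)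
  filter_upwards [coeFn_yShift s (yShift t f), coeFn_yShift (s + t) f, h] with p h1 h2 h3
  rw [h1, h2, h3, add_assoc]

theorem yShift_zero (f : L2Torus) : yShift 0 f = f := by
  refine Lp.ext ?_
  filter_upwards [coeFn_yShift 0 f] with p h1
  rw [h1, add_zero]

/-- Translates of a function on the circle. -/
def translate (w : C(Circ, ℂ)) (s : Circ) : C(Circ, ℂ) := ⟨fun y => w (y + s), by fun_prop⟩

theorem translate_apply (w : C(Circ, ℂ)) (s y : Circ) : translate w s y = w (y + s) := rfl

theorem yShift_yMul (s : Circ) (w : C(Circ, ℂ)) (f : L2Torus) :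
    yShift s (yMul w f) = yMul (translate w s) (yShift s f) := by
  refine Lp.ext ?_
  have h := (measurePreserving_yTranslate s).quasiMeasurePreserving.ae (coeFn_yMul w f)
  filter_upwards [coeFn_yShift s (yMul w f), coeFn_yMul (translate w s) (yShift s f),
    coeFn_yShift s f, h] with p h1 h2 h3 h4
  rw [h1, h2, h3, h4, translate_apply]

theorem yShift_characterLp (s : Circ) (j l : ℤ) :
    yShift s (characterLp j l) = (fourier l s : ℂ) • characterLp j l := by
  refine Lp.ext ?_
  have h := (measurePreserving_yTranslate s).quasiMeasurePreserving.ae (coeFn_characterLp j l)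
  filter_upwards [coeFn_yShift s (characterLp j l), coeFn_characterLp j l,
    Lp.coeFn_smul (fourier l s : ℂ) (characterLp j l), h] with p h1 h2 h3 h4
  rw [h1, h4, h3, Pi.smul_apply, h2, character_apply, character_apply, smul_eq_mul]
  have : (fourier l (p.2 + s) : ℂ) = fourier l p.2 * fourier l s := by
    rw [fourier_apply, fourier_apply, fourier_apply, smul_add, AddCircle.toCircle_add]
    rfl
  rw [this]; ring

theorem coef_yShift (s : Circ) (f : L2Torus) (j l : ℤ) :
    coef (yShift s f) j l = fourier l s * coef f j l := by
  have h1 : characterLp j l = (fourier l s : ℂ)⁻¹ • yShift s (characterLp j l) := by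
    have : (fourier l s : ℂ) ≠ 0 := by
      rw [fourier_apply]; exact Circle.coe_ne_zero _
    rw [yShift_characterLp, smul_smul, inv_mul_cancel₀ this, one_smul]
  have h2 : conj ((fourier l s : ℂ)⁻¹) = fourier l s := by
    rw [fourier_apply, ← Circle.coe_inv, ← Circle.coe_inv_eq_conj, inv_inv]
  rw [coef, h1, inner_smul_left, h2, LinearIsometry.inner_map_map, coef]

end Translation

/-! ### Weak y-derivatives on the Fourier side -/

section Derivative

/-- `g` is the weak `y`-derivative of `f`, in terms of Fourier coefficients. -/
def HasYDeriv (f g : L2Torus) : Prop := ∀ j l : ℤ, coef g j l = Complex.I * l * coef f j l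

/-- Multiplication by `w` obeys the product rule, with `w'` for the derivative of `w`. -/
def HasProductRule (w w' : C(Circ, ℂ)) : Prop :=
  ∀ f f', HasYDeriv f f' → HasYDeriv (yMul w f) (yMul w' f + yMul w f')

/-- Integration by parts, through Parseval: the multiplier i l is skew. -/
theorem HasYDeriv.inner_eq {f f' g g' : L2Torus} (hf : HasYDeriv f f') (hg : HasYDeriv g g') :
    ⟪f', g⟫_ℂ = -⟪f, g'⟫_ℂ := by
  have h1 := hasSum_coef f' g
  have h2 := (hasSum_coef f g').neg
  have h3 : (fun a : ℤ × ℤ => conj (coef f' a.1 a.2) * coef g a.1 a.2) =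
      fun a : ℤ × ℤ => -(conj (coef f a.1 a.2) * coef g' a.1 a.2) := by
    ext a
    rw [hf, hg, map_mul, map_mul, Complex.conj_I, map_intCast]
    ring
  rw [h3] at h1
  have h4 := h1.unique h2
  have : ((2 * π : ℝ) : ℂ) ^ 2 ≠ 0 := by
    have : (2 * π : ℝ) ≠ 0 := by positivity
    exact_mod_cast pow_ne_zero 2 this
  rw [← mul_neg] at h4
  exact mul_left_cancel₀ this h4

theorem HasYDeriv.comp_yShift {f f' : L2Torus} (hf : HasYDeriv f f') (s : Circ) :
    HasYDeriv (yShift s f) (yShift s f') := by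
  intro j l
  rw [coef_yShift, coef_yShift, hf]
  ring

/-- Parseval together with |e^(ils) - 1| ≤ |l s|. -/
theorem HasYDeriv.norm_yShift_sub_le {f f' : L2Torus} (hf : HasYDeriv f f') (s : ℝ) :
    ‖yShift (s : Circ) f - f‖ ≤ |s| * ‖f'‖ := by
  have h1 := hasSum_norm_coef_sq (yShift (s : Circ) f - f)
  have h2 := (hasSum_norm_coef_sq f').mul_left (s ^ 2)
  have h3 := hasSum_le (fun a => ?_) h1 h2
  · have hpi : (0 : ℝ) < (2 * π) ^ 2 := by positivity
    have h4 : ‖yShift (s : Circ) f - f‖ ^ 2 ≤ (|s| * ‖f'‖) ^ 2 := by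
      rw [mul_pow, sq_abs]
      nlinarith
    exact le_of_sq_le_sq h4 (by positivity)
  · rw [coef_sub, coef_yShift, hf, ← sub_one_mul, norm_mul, mul_pow, norm_mul, norm_mul,
      Complex.norm_I, one_mul, mul_pow, ← mul_assoc]
    refine mul_le_mul_of_nonneg_right ?_ (sq_nonneg _)
    have h5 : (fourier a.2 (s : Circ) : ℂ) = Complex.exp (Complex.I * ((a.2 * s : ℝ) : ℂ)) := by
      rw [fourier_coe_apply]
      congr 1
      have : (π : ℂ) ≠ 0 := by exact_mod_cast pi_ne_zero
      push_cast
      field_simp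
    have h6 : ‖(fourier a.2 (s : Circ) : ℂ) - 1‖ ≤ ‖(a.2 * s : ℝ)‖ := by
      rw [h5]; exact Real.norm_exp_I_mul_ofReal_sub_one_le
    calc ‖(fourier a.2 (s : Circ) : ℂ) - 1‖ ^ 2 ≤ ‖(a.2 * s : ℝ)‖ ^ 2 := by gcongr
      _ = s ^ 2 * ‖(a.2 : ℂ)‖ ^ 2 := by
        rw [Complex.norm_intCast, norm_mul, mul_pow, Real.norm_eq_abs, Real.norm_eq_abs, sq_abs s]
        ring

theorem hasProductRule_fourier (m : ℤ) :
    HasProductRule (fourier m) ((Complex.I * m) • fourier m) := by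
  intro f f' hf j l
  rw [coef_add, yMul_smul, coef_smul, coef_yMul_fourier, coef_yMul_fourier, hf]
  push_cast
  ring

theorem HasProductRule.add {w w' v v' : C(Circ, ℂ)} (h : HasProductRule w w')
    (h' : HasProductRule v v') : HasProductRule (w + v) (w' + v') := by
  intro f f' hf j l
  have h1 := h f f' hf j l
  have h2 := h' f f' hf j l
  rw [coef_add] at h1 h2
  simp only [yMul_add, coef_add]
  linear_combination h1 + h2

theorem HasProductRule.smul {w w' : C(Circ, ℂ)} (h : HasProductRule w w') (c : ℂ) :
    HasProductRule (c • w) (c • w') := by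
  intro f f' hf j l
  have h1 := h f f' hf j l
  rw [coef_add] at h1
  simp only [yMul_smul, coef_add, coef_smul]
  linear_combination c * h1

theorem hasProductRule_zero : HasProductRule 0 0 := by
  have := (hasProductRule_fourier 0).smul 0
  rwa [zero_smul, zero_smul] at this

theorem HasProductRule.sum {ι : Type*} {s : Finset ι} {w w' : ι → C(Circ, ℂ)}
    (h : ∀ i ∈ s, HasProductRule (w i) (w' i)) :
    HasProductRule (∑ i ∈ s, w i) (∑ i ∈ s, w' i) := by
  classical
  induction s using Finset.induction_on with
  | empty => simpa using hasProductRule_zero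
  | insert a s ha ih =>
    rw [Finset.sum_insert ha, Finset.sum_insert ha]
    exact (h a (Finset.mem_insert_self a s)).add
      (ih fun i hi => h i (Finset.mem_insert_of_mem hi))

end Derivative

/-! ### The operator is maximal dissipative -/

section Graph

/-- The operator `κ ∂ₓ² + ν ∂_y² - U(y) ∂ₓ`, in terms of Fourier coefficients. -/
def coefGraph (κ ν : ℝ) (U : C(Circ, ℂ)) : Submodule ℂ (L2Torus × L2Torus) where
  carrier := {q | ∀ j l : ℤ, coef q.2 j l =
    -(κ * (j : ℂ) ^ 2 + ν * (l : ℂ) ^ 2) * coef q.1 j l - Complex.I * j * coef (yMul U q.1) j l}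
  add_mem' := by
    intro p q hp hq j l
    rw [Prod.fst_add, Prod.snd_add, map_add, coef_add, coef_add, coef_add, hp, hq]
    ring
  zero_mem' := by
    intro j l
    simp [coef]
  smul_mem' := by
    intro c q hq j l
    rw [Prod.smul_fst, Prod.smul_snd, map_smul, coef_smul, coef_smul, coef_smul, hq]
    ring

theorem mem_coefGraph {κ ν : ℝ} {U : C(Circ, ℂ)} {q : L2Torus × L2Torus} :
    q ∈ coefGraph κ ν U ↔ ∀ j l : ℤ, coef q.2 j l =
      -(κ * (j : ℂ) ^ 2 + ν * (l : ℂ) ^ 2) * coef q.1 j l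
        - Complex.I * j * coef (yMul U q.1) j l := Iff.rfl

theorem integrable_mul_character (f : L2Torus) (j l : ℤ) :
    Integrable (fun p : Torus => f p * character (-j) (-l) p) := by
  refine (L2.integrable_inner (𝕜 := ℂ) (characterLp j l) f).congr ?_
  filter_upwards [coeFn_characterLp j l] with p hp
  rw [hp, character_neg]
  simp

theorem coe_coefGraph (κ ν : ℝ) {u : Circ → ℝ} {U : C(Circ, ℂ)} (hU : ∀ y, U y = u y) :
    (coefGraph κ ν U : Set (L2Torus × L2Torus)) = advectionDiffusionGraph κ ν u := by
  ext q
  refine forall_congr' fun j => forall_congr' fun l => ?_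
  have h1 : ∫ p : Torus, q.1 p *
        (-(κ * (j : ℂ) ^ 2 + ν * (l : ℂ) ^ 2) * character (-j) (-l) p
          + u p.2 * (-(Complex.I * j) * character (-j) (-l) p)) =
      -(κ * (j : ℂ) ^ 2 + ν * (l : ℂ) ^ 2) * coef q.1 j l
        - Complex.I * j * coef (yMul U q.1) j l := by
    rw [coef_eq_integral, coef_eq_integral, ← integral_const_mul, ← integral_const_mul,
      ← integral_sub ((integrable_mul_character _ j l).const_mul _)
        ((integrable_mul_character _ j l).const_mul _)]
    refine integral_congr_ae ?_
    filter_upwards [coeFn_yMul U q.1] with p hp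
    rw [hp, hU]
    ring
  rw [h1, coef_eq_integral]

theorem isClosed_coefGraph (κ ν : ℝ) (U : C(Circ, ℂ)) :
    IsClosed (coefGraph κ ν U : Set (L2Torus × L2Torus)) := by
  have : (coefGraph κ ν U : Set (L2Torus × L2Torus)) = ⋂ j : ℤ, ⋂ l : ℤ, {q | coef q.2 j l =
    -(κ * (j : ℂ) ^ 2 + ν * (l : ℂ) ^ 2) * coef q.1 j l
      - Complex.I * j * coef (yMul U q.1) j l} := by
    ext q
    simp only [mem_iInter]
    rfl
  rw [this]
  refine isClosed_iInter fun j => isClosed_iInter fun l => isClosed_eq ?_ ?_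
  · exact (continuous_coef j l).comp continuous_snd
  · exact (((continuous_coef j l).comp continuous_fst).const_mul _).sub
      (((continuous_coef j l).comp ((yMul U).continuous.comp continuous_fst)).const_mul _)

theorem modeProj_mem_coefGraph {κ ν : ℝ} {U : C(Circ, ℂ)} {q : L2Torus × L2Torus}
    (hq : q ∈ coefGraph κ ν U) (k : ℤ) : (modeProj k q.1, modeProj k q.2) ∈ coefGraph κ ν U := by
  intro j l
  simp only [← modeProj_yMul, coef_modeProj]
  split_ifs
  · exact hq j l
  · simp

theorem modeProj_modeProj (k : ℤ) (f : L2Torus) : modeProj k (modeProj k f) = modeProj k f := by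
  refine coef_ext fun j l => ?_
  simp only [coef_modeProj]
  split_ifs <;> rfl

theorem norm_modeProj_le (k : ℤ) (f : L2Torus) : ‖modeProj k f‖ ≤ ‖f‖ :=
  Submodule.norm_starProjection_apply_le _ _

theorem characterLp_mem_coefGraph (κ ν : ℝ) (U : C(Circ, ℂ)) (j l : ℤ) :
    (characterLp j l, -(κ * (j : ℂ) ^ 2 + ν * (l : ℂ) ^ 2) • characterLp j l
      - (Complex.I * j) • yMul U (characterLp j l)) ∈ coefGraph κ ν U := by
  intro j' l'
  have h1 : coef (yMul U (characterLp j l)) j' l' =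
      if j' = j then coef (yMul U (characterLp j l)) j' l' else 0 := by
    rw [← coef_modeProj, modeProj_yMul, modeProj_characterLp, if_pos rfl]
  rw [coef_sub, coef_smul, coef_smul]
  by_cases h : j' = j
  · rw [h, coef_characterLp]
    by_cases h' : l' = l
    · rw [h']
    · rw [if_neg (by simp [h'])]; ring
  · rw [if_neg h] at h1
    rw [h1, coef_characterLp, if_neg (by simp [h])]
    ring

/-- On a single mode the operator acts by two `y`-derivatives and a bounded perturbation. -/
theorem exists_yDeriv_of_mem_coefGraph {κ ν : ℝ} (hν : 0 < ν) {U : C(Circ, ℂ)} {k : ℤ}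
    {f g : L2Torus} (hf : modeProj k f = f) (hfg : (f, g) ∈ coefGraph κ ν U) :
    ∃ f₁ f₂, HasYDeriv f f₁ ∧ HasYDeriv f₁ f₂ ∧
      g = (-(κ * (k : ℝ) ^ 2 : ℝ) : ℂ) • f + (ν : ℂ) • f₂ - (Complex.I * k) • yMul U f := by
  have hνc : (ν : ℂ) ≠ 0 := by exact_mod_cast hν.ne'
  -- The equation solved for the second y-derivative. Every other term is in L², because on one mode
  -- the transport is a bounded multiplication.
  set f₂ := (ν : ℂ)⁻¹ • (g + ((κ * (k : ℝ) ^ 2 : ℝ) : ℂ) • f + (Complex.I * k) • yMul U f) with hf₂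
  have hg : g = (-(κ * (k : ℝ) ^ 2 : ℝ) : ℂ) • f + (ν : ℂ) • f₂ - (Complex.I * k) • yMul U f := by
    rw [hf₂, smul_smul, mul_inv_cancel₀ hνc, one_smul, neg_smul]
    abel
  have h2 : ∀ j l, coef f₂ j l = -(l : ℂ) ^ 2 * coef f j l := by
    intro j l
    rw [hf₂, coef_smul, coef_add, coef_add, coef_smul, coef_smul]
    have h3 := hfg j l
    simp only at h3
    by_cases hj : j = k
    · rw [h3, hj]
      push_cast
      field_simp
      ring
    · have h4 : coef f j l = 0 := by rw [← hf, coef_modeProj, if_neg hj]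
      have h5 : coef (yMul U f) j l = 0 := by
        rw [← hf, ← modeProj_yMul, coef_modeProj, if_neg hj]
      rw [h3, h4, h5]
      ring
  -- The first derivative lies between f and f₂: l² ≤ 1 + l⁴.
  have hs : Summable fun a : ℤ × ℤ => ‖Complex.I * a.2 * coef f a.1 a.2‖ ^ 2 := by
    refine Summable.of_nonneg_of_le (fun _ => by positivity) (fun a => ?_)
      ((hasSum_norm_coef_sq f).summable.add (hasSum_norm_coef_sq f₂).summable)
    rw [h2, norm_mul, norm_mul, norm_mul, norm_neg, norm_pow, Complex.norm_I, one_mul]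
    have : ‖(a.2 : ℂ)‖ ^ 2 ≤ 1 + (‖(a.2 : ℂ)‖ ^ 2) ^ 2 := by
      nlinarith [sq_nonneg (‖(a.2 : ℂ)‖ ^ 2 - 1), sq_nonneg (‖(a.2 : ℂ)‖)]
    calc (‖(a.2 : ℂ)‖ * ‖coef f a.1 a.2‖) ^ 2
        = ‖(a.2 : ℂ)‖ ^ 2 * ‖coef f a.1 a.2‖ ^ 2 := by ring
      _ ≤ (1 + (‖(a.2 : ℂ)‖ ^ 2) ^ 2) * ‖coef f a.1 a.2‖ ^ 2 := by gcongr
      _ = _ := by ring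
  obtain ⟨f₁, hf₁⟩ := exists_coef_eq hs
  refine ⟨f₁, f₂, hf₁, fun j l => ?_, hg⟩
  rw [h2, hf₁]
  linear_combination (-(l : ℂ) ^ 2 * coef f j l) * Complex.I_sq

theorem inner_yMul_right_im {U : C(Circ, ℂ)} (hU : star U = U) (f : L2Torus) :
    (⟪f, yMul U f⟫_ℂ).im = 0 := by
  rw [← Complex.conj_eq_iff_im, inner_conj_symm, inner_yMul_left, hU]

theorem re_inner_mode {κ ν : ℝ} {U : C(Circ, ℂ)} (hU : star U = U) {k : ℤ} {f f₁ f₂ : L2Torus}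
    (h₁ : HasYDeriv f f₁) (h₂ : HasYDeriv f₁ f₂) :
    (⟪f, (-(κ * (k : ℝ) ^ 2 : ℝ) : ℂ) • f + (ν : ℂ) • f₂ - (Complex.I * k) • yMul U f⟫_ℂ).re =
      -(κ * (k : ℝ) ^ 2) * ‖f‖ ^ 2 - ν * ‖f₁‖ ^ 2 := by
  have h3 : ⟪f, f₂⟫_ℂ = -⟪f₁, f₁⟫_ℂ := by rw [h₁.inner_eq h₂, neg_neg]
  have h4 : ∀ g : L2Torus, ⟪g, g⟫_ℂ = ((‖g‖ ^ 2 : ℝ) : ℂ) := fun g => by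
    rw [inner_self_eq_norm_sq_to_K]; norm_cast
  have h5 := inner_yMul_right_im hU f
  rw [inner_sub_right, inner_add_right, inner_smul_right, inner_smul_right, inner_smul_right, h3,
    h4, h4]
  simp only [Complex.sub_re, Complex.add_re, Complex.mul_re, Complex.mul_im, Complex.neg_re,
    Complex.neg_im, Complex.ofReal_re, Complex.ofReal_im, Complex.I_re, Complex.I_im,
    Complex.intCast_re, Complex.intCast_im, h5]
  ring

theorem hasSum_inner_modeProj (f g : L2Torus) :
    HasSum (fun k : ℤ => ⟪modeProj k f, modeProj k g⟫_ℂ) ⟪f, g⟫_ℂ := by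
  have hpi : ((2 * π : ℝ) : ℂ) ^ 2 ≠ 0 := by
    have : (2 * π : ℝ) ≠ 0 := by positivity
    exact_mod_cast pow_ne_zero 2 this
  have hfib : ∀ k : ℤ, HasSum (fun l : ℤ => conj (coef f k l) * coef g k l)
      (((2 * π : ℝ) : ℂ) ^ 2 * ⟪modeProj k f, modeProj k g⟫_ℂ) := by
    intro k
    have hinj : Function.Injective fun l : ℤ => (k, l) := Prod.mk_right_injective k
    have h1 := hasSum_coef (modeProj k f) (modeProj k g)
    rw [← hinj.hasSum_iff] at h1
    · refine h1.congr_fun fun l => ?_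
      simp only [Function.comp_apply, coef_modeProj, if_true]
    · intro a ha
      have : a.1 ≠ k := fun h => ha ⟨a.2, Prod.ext h.symm rfl⟩
      rw [coef_modeProj, if_neg this, map_zero, zero_mul]
  have h2 := (hasSum_coef f g).prod_fiberwise hfib
  rwa [hasSum_mul_left_iff hpi] at h2

/-- The inner product is summed over modes: on each one the transport is bounded and skew, and the
diffusion can be integrated by parts. -/
theorem re_inner_nonpos_of_mem_coefGraph {κ ν : ℝ} (hκ : 0 ≤ κ) (hν : 0 < ν) {U : C(Circ, ℂ)}
    (hU : star U = U) {q : L2Torus × L2Torus} (hq : q ∈ coefGraph κ ν U) :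
    (⟪q.1, q.2⟫_ℂ).re ≤ 0 := by
  refine hasSum_le (fun k => ?_) (Complex.hasSum_re (hasSum_inner_modeProj q.1 q.2)) hasSum_zero
  obtain ⟨f₁, f₂, h₁, h₂, hg⟩ := exists_yDeriv_of_mem_coefGraph hν (modeProj_modeProj k q.1)
    (modeProj_mem_coefGraph hq k)
  rw [hg, re_inner_mode hU h₁ h₂]
  have e1 : 0 ≤ κ * (k : ℝ) ^ 2 * ‖modeProj k q.1‖ ^ 2 := by positivity
  have e2 : 0 ≤ ν * ‖f₁‖ ^ 2 := by positivity
  linarith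

/-- Dissipativity bounds r - A below on its graph norm, so a closed A gives a closed range; `horth`
makes that range dense. -/
theorem isMaxDissipative_of_isClosed {X : Type*} [NormedAddCommGroup X] [InnerProductSpace ℂ X]
    [CompleteSpace X] {A : Submodule ℂ (X × X)} (hcl : IsClosed (A : Set (X × X)))
    (hdiss : ∀ q ∈ A, (⟪q.1, q.2⟫_ℂ).re ≤ 0) (hdense : Dense {f : X | ∃ g, (f, g) ∈ A})
    (horth : ∀ r : ℝ, 0 < r → ∀ w : X, (∀ q ∈ A, ⟪(r : ℂ) • q.1 - q.2, w⟫_ℂ = 0) → w = 0) :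
    IsMaxDissipative A := by
  refine ⟨hdiss, fun r hr g => ?_, hdense⟩
  have : CompleteSpace A := hcl.completeSpace_coe
  set L : A →L[ℂ] X := (((r : ℂ) • ContinuousLinearMap.fst ℂ X X) -
    ContinuousLinearMap.snd ℂ X X).comp A.subtypeL with hL
  have hLa : ∀ q : A, L q = (r : ℂ) • (q : X × X).1 - (q : X × X).2 := fun q => rfl
  have hanti : AntilipschitzWith (Real.toNNReal (r⁻¹ + 2)) L := by
    refine L.antilipschitz_of_bound fun q => ?_
    have h1 := IsMaxDissipative.norm_fst_le hdiss hr q.2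
    rw [← hLa] at h1
    have h2 : ‖(q : X × X).2‖ ≤ 2 * ‖L q‖ := by
      have : (q : X × X).2 = (r : ℂ) • (q : X × X).1 - L q := by rw [hLa]; abel
      rw [this]
      refine (norm_sub_le _ _).trans ?_
      rw [norm_smul, Complex.norm_real, Real.norm_eq_abs, abs_of_pos hr]
      have : r * ‖(q : X × X).1‖ ≤ ‖L q‖ := by
        calc r * ‖(q : X × X).1‖ ≤ r * (r⁻¹ * ‖L q‖) := by gcongr
          _ = ‖L q‖ := by field_simp
      linarith
    rw [Real.coe_toNNReal _ (by positivity), Submodule.coe_norm, Prod.norm_def]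
    have : 0 ≤ r⁻¹ * ‖L q‖ := by positivity
    refine max_le ?_ ?_ <;> linarith [norm_nonneg (L q)]
  have hclr : IsClosed (LinearMap.range (L : A →ₗ[ℂ] X) : Set X) :=
    hanti.isClosed_range L.uniformContinuous
  have htop : LinearMap.range (L : A →ₗ[ℂ] X) = ⊤ := by
    rw [← hclr.submodule_topologicalClosure_eq, Submodule.topologicalClosure_eq_top_iff,
      Submodule.eq_bot_iff]
    intro w hw
    refine horth r hr w fun q hq => ?_
    exact (Submodule.mem_orthogonal _ _).1 hw _ ⟨⟨q, hq⟩, rfl⟩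
  obtain ⟨q, hq⟩ : g ∈ LinearMap.range (L : A →ₗ[ℂ] X) := htop ▸ Submodule.mem_top
  exact ⟨q, q.2, hq⟩

theorem dense_domain_coefGraph (κ ν : ℝ) (U : C(Circ, ℂ)) :
    Dense {f : L2Torus | ∃ g, (f, g) ∈ coefGraph κ ν U} := by
  have h1 : Submodule.span ℂ (range fun a : ℤ × ℤ => characterLp a.1 a.2) ≤
      (coefGraph κ ν U).map (LinearMap.fst ℂ L2Torus L2Torus) := by
    rw [Submodule.span_le]
    rintro - ⟨a, rfl⟩
    exact ⟨_, characterLp_mem_coefGraph κ ν U a.1 a.2, rfl⟩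
  have h2 : Dense ((coefGraph κ ν U).map (LinearMap.fst ℂ L2Torus L2Torus) : Set L2Torus) := by
    refine (Submodule.dense_iff_topologicalClosure_eq_top.2 ?_)
    rw [eq_top_iff, ← span_characterLp_closure_eq_top]
    exact Submodule.topologicalClosure_mono h1
  refine h2.mono ?_
  rintro - ⟨q, hq, rfl⟩
  exact ⟨q.2, hq⟩

theorem isMaxDissipative_coefGraph {κ ν : ℝ} (hκ : 0 ≤ κ) (hν : 0 < ν) {U : C(Circ, ℂ)}
    (hU : star U = U) : IsMaxDissipative (coefGraph κ ν U) := by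
  refine isMaxDissipative_of_isClosed (isClosed_coefGraph κ ν U)
    (fun q hq => re_inner_nonpos_of_mem_coefGraph hκ hν hU hq) (dense_domain_coefGraph κ ν U)
    fun r hr w hw => ?_
  -- Orthogonality to the images of characters says that w solves the adjoint equation, the same one
  -- with U replaced by -U. Dissipativity of that operator forces w = 0.
  have hmem : (w, (r : ℂ) • w) ∈ coefGraph κ ν ((-1 : ℂ) • U) := by
    intro j l
    have h1 := hw _ (characterLp_mem_coefGraph κ ν U j l)
    simp only [inner_sub_left, inner_smul_left, map_neg, map_add, map_mul, map_pow,
      Complex.conj_ofReal, map_intCast, Complex.conj_I, inner_yMul_left, hU] at h1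
    change (r : ℂ) * coef w j l - (-(κ * (j : ℂ) ^ 2 + ν * (l : ℂ) ^ 2) * coef w j l -
      -Complex.I * j * coef (yMul U w) j l) = 0 at h1
    simp only [coef_smul, yMul_smul]
    linear_combination h1
  have hU' : star ((-1 : ℂ) • U) = (-1 : ℂ) • U := by
    rw [star_smul, hU]; simp
  have h2 := re_inner_nonpos_of_mem_coefGraph hκ hν hU' hmem
  have h3 : (⟪w, (r : ℂ) • w⟫_ℂ).re = r * ‖w‖ ^ 2 := by
    rw [inner_smul_right, inner_self_eq_norm_sq_to_K, Complex.re_ofReal_mul]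
    norm_cast
  simp only [h3] at h2
  have h4 : ‖w‖ ^ 2 ≤ 0 := by nlinarith
  rw [← norm_eq_zero]
  exact pow_eq_zero_iff two_ne_zero |>.1 (le_antisymm h4 (sq_nonneg _))

end Graph

/-! ### Coercivity from translates of the increment -/

section Coercivity

theorem inner_self_L2 (g : L2Torus) : ⟪g, g⟫_ℂ = ((‖g‖ ^ 2 : ℝ) : ℂ) := by
  rw [inner_self_eq_norm_sq_to_K]; norm_cast

theorem inner_yMul_yMul_self (w : C(Circ, ℂ)) (f : L2Torus) :
    ⟪f, yMulL (star w * w) f⟫_ℂ = ((‖yMul w f‖ ^ 2 : ℝ) : ℂ) := by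
  rw [← inner_self_L2, inner_yMul_left, yMul_yMul, yMulL_apply]

/-- A pointwise lower bound on `∑ |wᵢ|²` gives a lower bound on `∑ ‖wᵢ f‖²`. -/
theorem le_sum_norm_yMul_sq {ι : Type*} {s : Finset ι} {w : ι → C(Circ, ℂ)} {m : ℝ}
    (hm : ∀ y, m ≤ ∑ i ∈ s, ‖w i y‖ ^ 2) (f : L2Torus) :
    m * ‖f‖ ^ 2 ≤ ∑ i ∈ s, ‖yMul (w i) f‖ ^ 2 := by
  -- The square root of the excess turns the pointwise inequality into the identity ∑|wᵢ|² = m +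
  -- |r|².
  set r : C(Circ, ℂ) := ⟨fun y => ((√(∑ i ∈ s, ‖w i y‖ ^ 2 - m) : ℝ) : ℂ), by fun_prop⟩ with hr
  have h1 : ∑ i ∈ s, star (w i) * w i = (m : ℂ) • fourier 0 + star r * r := by
    ext y
    have e1 : ∀ z : ℂ, star z * z = ((‖z‖ ^ 2 : ℝ) : ℂ) := fun z => by
      rw [RCLike.star_def, ← Complex.normSq_eq_conj_mul_self, Complex.normSq_eq_norm_sq]
    have e2 : r y = ((√(∑ i ∈ s, ‖w i y‖ ^ 2 - m) : ℝ) : ℂ) := rfl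
    simp only [ContinuousMap.coe_sum, Finset.sum_apply, ContinuousMap.mul_apply,
      ContinuousMap.star_apply, ContinuousMap.add_apply, ContinuousMap.smul_apply, e1, e2,
      fourier_zero, smul_eq_mul, mul_one, Complex.norm_real, Real.norm_eq_abs, sq_abs]
    rw [Real.sq_sqrt (sub_nonneg.2 (hm y))]
    push_cast
    ring
  have hone : yMulL (fourier 0) f = f := coef_ext fun j l => by
    rw [yMulL_apply, coef_yMul_fourier, sub_zero]
  have h2 : ((∑ i ∈ s, ‖yMul (w i) f‖ ^ 2 : ℝ) : ℂ) =
      ((m * ‖f‖ ^ 2 + ‖yMul r f‖ ^ 2 : ℝ) : ℂ) := by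
    have h3 : ⟪f, yMulL (∑ i ∈ s, star (w i) * w i) f⟫_ℂ =
        ∑ i ∈ s, ⟪f, yMulL (star (w i) * w i) f⟫_ℂ := by
      rw [map_sum, sum_apply, inner_sum]
    rw [h1, map_add, map_smul, add_apply, smul_apply,
      inner_add_right, inner_smul_right, hone, inner_self_L2, inner_yMul_yMul_self] at h3
    simp_rw [inner_yMul_yMul_self] at h3
    push_cast at h3 ⊢
    exact h3.symm
  have h4 := Complex.ofReal_injective h2
  rw [h4]
  linarith [sq_nonneg ‖yMul r f‖]

/-- Multiplication by the translated w is T_t w T_(-t). The outer T_t is isometric and the inner one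
differs from the identity by |t| ‖f₁‖. -/
theorem norm_yMul_translate_le {w : C(Circ, ℂ)} {d : ℝ} (hd : ∀ y, ‖w y‖ ≤ d) {f f₁ : L2Torus}
    (h₁ : HasYDeriv f f₁) (t : ℝ) :
    ‖yMul (translate w t) f‖ ≤ ‖yMul w f‖ + d * (|t| * ‖f₁‖) := by
  have hd0 : 0 ≤ d := (norm_nonneg _).trans (hd 0)
  have h2 : yMul (translate w t) f = yShift t (yMul w (yShift (-t : ℝ) f)) := by
    rw [yShift_yMul, yShift_yShift, ← AddCircle.coe_add, add_neg_cancel, AddCircle.coe_zero,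
      yShift_zero]
  have h3 : yMul w (yShift (-t : ℝ) f) = yMul w f + yMul w (yShift (-t : ℝ) f - f) := by
    rw [map_sub]; abel
  rw [h2, LinearIsometry.norm_map, h3]
  refine (norm_add_le _ _).trans (add_le_add_right ?_ _)
  refine (norm_yMul_apply_le hd _).trans (mul_le_mul_of_nonneg_left ?_ hd0)
  have := h₁.norm_yShift_sub_le (-t)
  rwa [abs_neg] at this

/-- w may vanish at points, but not at four consecutive translates at once. Each translate costs at
most 3|s| ‖f₁‖; squaring gives 2 and 2·9, and the four terms give 8 and 72. -/
theorem coercivity {w : C(Circ, ℂ)} {d m s : ℝ} (hd : ∀ y, ‖w y‖ ≤ d)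
    (hm : ∀ y : Circ, m ≤ ∑ j ∈ Finset.range 4, ‖w (y + ((j * s : ℝ) : Circ))‖ ^ 2)
    {f f₁ : L2Torus} (h₁ : HasYDeriv f f₁) :
    m * ‖f‖ ^ 2 ≤ 8 * ‖yMul w f‖ ^ 2 + 72 * (d ^ 2 * s ^ 2 * ‖f₁‖ ^ 2) := by
  have hd0 : 0 ≤ d := (norm_nonneg _).trans (hd 0)
  have h2 := le_sum_norm_yMul_sq (w := fun j : ℕ => translate w ((j * s : ℝ) : Circ)) hm f
  refine h2.trans ?_
  have h3 : ∀ j ∈ Finset.range 4, ‖yMul (translate w ((j * s : ℝ) : Circ)) f‖ ^ 2 ≤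
      2 * ‖yMul w f‖ ^ 2 + 18 * (d ^ 2 * s ^ 2 * ‖f₁‖ ^ 2) := by
    intro j hj
    have h4 := norm_yMul_translate_le hd h₁ (j * s)
    have hj3 : (j : ℝ) ≤ 3 := by
      have : j ≤ 3 := by have := Finset.mem_range.1 hj; omega
      exact_mod_cast this
    have h5 : d * (|(j : ℝ) * s| * ‖f₁‖) ≤ 3 * (d * |s| * ‖f₁‖) := by
      rw [abs_mul, Nat.abs_cast]
      have : 0 ≤ d * |s| * ‖f₁‖ := by positivity
      nlinarith
    have h6 : ‖yMul (translate w ((j * s : ℝ) : Circ)) f‖ ^ 2 ≤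
        (‖yMul w f‖ + 3 * (d * |s| * ‖f₁‖)) ^ 2 := by
      gcongr; linarith
    have h7 : d ^ 2 * s ^ 2 * ‖f₁‖ ^ 2 = (d * |s| * ‖f₁‖) ^ 2 := by
      rw [mul_pow, mul_pow, sq_abs]
    rw [h7]
    nlinarith [sq_nonneg (‖yMul w f‖ - 3 * (d * |s| * ‖f₁‖))]
  refine (Finset.sum_le_sum h3).trans (le_of_eq ?_)
  rw [Finset.sum_const, Finset.card_range, nsmul_eq_mul]
  push_cast
  ring

end Coercivity

/-! ### Terms in the derivative of the Lyapunov functional -/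

section Commutator

theorem le_re_inner_yMul_yShift {w : C(Circ, ℂ)} {d s : ℝ} (hd : ∀ y, ‖w y‖ ≤ d) {f f₁ : L2Torus}
    (h₁ : HasYDeriv f f₁) : 1 / 2 * ‖yMul w f‖ ^ 2 - 1 / 2 * (d ^ 2 * s ^ 2 * ‖f₁‖ ^ 2) ≤
      (⟪yMul w f, yMul w (yShift s f)⟫_ℂ).re := by
  have hd0 : 0 ≤ d := (norm_nonneg _).trans (hd 0)
  have h2 : ‖yMul w (yShift s f) - yMul w f‖ ≤ d * (|s| * ‖f₁‖) := by
    rw [← map_sub]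
    exact (norm_yMul_apply_le hd _).trans
      (mul_le_mul_of_nonneg_left (h₁.norm_yShift_sub_le s) hd0)
  have h3 := norm_sub_sq (𝕜 := ℂ) (yMul w (yShift s f)) (yMul w f)
  have h4 : RCLike.re (⟪yMul w (yShift s f), yMul w f⟫_ℂ) =
      (⟪yMul w f, yMul w (yShift s f)⟫_ℂ).re := inner_re_symm (𝕜 := ℂ) _ _
  rw [h4] at h3
  have h5 : ‖yMul w (yShift s f) - yMul w f‖ ^ 2 ≤ d ^ 2 * s ^ 2 * ‖f₁‖ ^ 2 := by
    calc _ ≤ (d * (|s| * ‖f₁‖)) ^ 2 := by gcongr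
      _ = _ := by rw [mul_pow, mul_pow, sq_abs]; ring
  nlinarith [sq_nonneg ‖yMul w (yShift s f)‖]

/-- One integration by parts in each pairing removes f₂, leaving only f₁ and the derivative w' of
the weight. -/
theorem norm_inner_diffusion_le {w w' : C(Circ, ℂ)} (hw : star w = w) (hr : HasProductRule w w')
    {d d' : ℝ} (hd : ∀ y, ‖w y‖ ≤ d) (hd' : ∀ y, ‖w' y‖ ≤ d') (s : Circ) {f f₁ f₂ : L2Torus}
    (h₁ : HasYDeriv f f₁) (h₂ : HasYDeriv f₁ f₂) :
    ‖⟪f, yMul w (yShift s f₂)⟫_ℂ + ⟪f₂, yMul w (yShift s f)⟫_ℂ‖ ≤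
      2 * d * ‖f₁‖ ^ 2 + 2 * d' * (‖f‖ * ‖f₁‖) := by
  have e1 := h₂.inner_eq (hr _ _ (h₁.comp_yShift s))
  have e2 := (hr _ _ h₁).inner_eq (h₂.comp_yShift s)
  have e3 : ⟪f, yMul w (yShift s f₂)⟫_ℂ = ⟪yMul w f, yShift s f₂⟫_ℂ := by
    rw [inner_yMul_left, hw]
  have e4 : ⟪f, yMul w (yShift s f₂)⟫_ℂ = -⟪yMul w' f + yMul w f₁, yShift s f₁⟫_ℂ := by
    rw [e3, e2, neg_neg]
  rw [e4, e1]
  have b1 : ‖⟪yMul w' f + yMul w f₁, yShift s f₁⟫_ℂ‖ ≤ (d' * ‖f‖ + d * ‖f₁‖) * ‖f₁‖ := by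
    refine (norm_inner_le_norm _ _).trans ?_
    rw [LinearIsometry.norm_map]
    gcongr
    exact (norm_add_le _ _).trans (add_le_add (norm_yMul_apply_le hd' _) (norm_yMul_apply_le hd _))
  have b2 : ‖⟪f₁, yMul w' (yShift s f) + yMul w (yShift s f₁)⟫_ℂ‖ ≤
      ‖f₁‖ * (d' * ‖f‖ + d * ‖f₁‖) := by
    refine (norm_inner_le_norm _ _).trans ?_
    gcongr
    refine (norm_add_le _ _).trans ?_
    have c1 := norm_yMul_apply_le hd' (yShift s f)
    have c2 := norm_yMul_apply_le hd (yShift s f₁)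
    rw [LinearIsometry.norm_map] at c1 c2
    exact add_le_add c1 c2
  refine (norm_add_le _ _).trans ?_
  rw [norm_neg, norm_neg]
  nlinarith

/-- T_s U = (U + w) T_s. The two U contributions cancel by self-adjointness, and w leaves the
pairing of w f with w T_s f, the source of decay. -/
theorem inner_commutator {U w : C(Circ, ℂ)} (hU : star U = U) (hw : star w = w) {s : Circ}
    (hUw : w = translate U s - U) (K ν : ℝ) (k : ℤ) (f f₂ : L2Torus) {g : L2Torus}
    (hg : g = (-K : ℂ) • f + (ν : ℂ) • f₂ - (Complex.I * k) • yMul U f) :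
    ⟪f, yMul w (yShift s g)⟫_ℂ + ⟪g, yMul w (yShift s f)⟫_ℂ =
      -(2 * K) * ⟪f, yMul w (yShift s f)⟫_ℂ
      + ν * (⟪f, yMul w (yShift s f₂)⟫_ℂ + ⟪f₂, yMul w (yShift s f)⟫_ℂ)
      - Complex.I * k * ⟪yMul w f, yMul w (yShift s f)⟫_ℂ := by
  have e1 : ⟪f, yMul w (yShift s (yMul U f))⟫_ℂ =
      ⟪yMul U f, yMul w (yShift s f)⟫_ℂ + ⟪yMul w f, yMul w (yShift s f)⟫_ℂ := by
    have e2 : translate U s = U + w := by rw [hUw]; abel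
    rw [yShift_yMul, e2, yMul_add, map_add, inner_add_right, inner_yMul_left U, hU,
      inner_yMul_left w, hw, yMul_yMul w U, yMul_yMul U w, mul_comm w U]
  rw [hg]
  simp only [map_add, map_sub, map_smul, inner_add_left, inner_add_right, inner_sub_left,
    inner_sub_right, inner_smul_left, inner_smul_right, e1, map_mul, map_neg, Complex.conj_I,
    map_intCast, Complex.conj_ofReal]
  ring

end Commutator

/-! ### The Lyapunov estimate on one mode -/

section Decay

/-- The Lyapunov operator `1 - i b w(y) T_s`, with `T_s` the translation, on a single mode. -/
def lyapunovOp (k : ℤ) (b : ℝ) (w : C(Circ, ℂ)) (s : Circ) : L2Torus →L[ℂ] L2Torus :=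
  (modeProj k).comp ((1 - (Complex.I * b) • (yMul w).comp
    (yShift s).toContinuousLinearMap).comp (modeProj k))

theorem inner_lyapunovOp (k : ℤ) (b : ℝ) (w : C(Circ, ℂ)) (s : Circ) (f g : L2Torus) :
    ⟪f, lyapunovOp k b w s g⟫_ℂ = ⟪modeProj k f, modeProj k g⟫_ℂ -
      Complex.I * b * ⟪modeProj k f, yMul w (yShift s (modeProj k g))⟫_ℂ := by
  have : lyapunovOp k b w s g = modeProj k (modeProj k g -
    (Complex.I * b) • yMul w (yShift s (modeProj k g))) := rfl
  rw [this, ← inner_modeProj, inner_sub_right, inner_smul_right]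

/-- Enhanced dissipation on the `k`-th mode, given a translation `s` for which the increment
`w = U(· + s) - U` is smooth and nondegenerate. -/
theorem norm_comp_modeProj_le {κ ν : ℝ} (hκ : 0 ≤ κ) (hν : 0 < ν) {U w w' : C(Circ, ℂ)}
    (hU : star U = U) {s : ℝ} (hUw : w = translate U s - U) (hr : HasProductRule w w')
    {d d' m β c : ℝ} (hβ : 0 ≤ β) (hc : 0 ≤ c) (hd : ∀ y, ‖w y‖ ≤ d) (hd' : ∀ y, ‖w' y‖ ≤ d')
    (hm : ∀ y : Circ, m ≤ ∑ j ∈ Finset.range 4, ‖w (y + ((j * s : ℝ) : Circ))‖ ^ 2)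
    (hβd : β * d ≤ 1 / 2) {k : ℤ}
    (hmain : ∀ x z : ℝ, 0 ≤ x → 0 ≤ z → -2 * ν * z ^ 2 + β * (ν * (2 * d * z ^ 2 + 2 * d' * (x * z))
      - |(k : ℝ)| * m / 16 * x ^ 2 + 5 * |(k : ℝ)| * (d ^ 2 * s ^ 2 * z ^ 2)) ≤ -(3 / 2 * c) * x ^ 2)
    {S : ℝ → L2Torus →L[ℂ] L2Torus}
    (hS : IsSemigroupGeneratedBy S (coefGraph κ ν U : Set (L2Torus × L2Torus))) {t : ℝ}
    (ht : 0 ≤ t) : ‖(S t).comp (modeProj k)‖ ≤ 2 * Real.exp (-(c / 2) * t) := by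
  have hw : star w = w := by
    rw [hUw, star_sub, hU]
    congr 1
    ext y
    exact congrArg (fun V : C(Circ, ℂ) => V (y + s)) hU
  -- The sign of the cross term follows the sign of k, so that the commutator always dissipates.
  obtain ⟨σ, hσ1, hσk⟩ : ∃ σ : ℝ, |σ| = 1 ∧ σ * k = |(k : ℝ)| := by
    rcases le_total 0 (k : ℝ) with h | h
    · exact ⟨1, by simp, by rw [abs_of_nonneg h, one_mul]⟩
    · exact ⟨-1, by simp, by rw [abs_of_nonpos h, neg_one_mul]⟩
  set b := β * σ with hb
  have hab : |b| = β := by rw [hb, abs_mul, hσ1, mul_one, abs_of_nonneg hβ]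
  have hbound : ∀ f : L2Torus, |b * (⟪f, yMul w (yShift s f)⟫_ℂ).im| ≤ 1 / 2 * ‖f‖ ^ 2 := by
    intro f
    rw [abs_mul, hab]
    have h1 : |(⟪f, yMul w (yShift s f)⟫_ℂ).im| ≤ ‖f‖ * (d * ‖f‖) := by
      refine (Complex.abs_im_le_norm _).trans ((norm_inner_le_norm _ _).trans ?_)
      have h2 := norm_yMul_apply_le hd (yShift s f)
      rw [LinearIsometry.norm_map] at h2
      gcongr
    calc _ ≤ β * (‖f‖ * (d * ‖f‖)) := by gcongr
      _ = β * d * ‖f‖ ^ 2 := by ring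
      _ ≤ _ := by gcongr
  have hform : ∀ f g : L2Torus, (⟪f, lyapunovOp k b w s g⟫_ℂ).re =
      (⟪modeProj k f, modeProj k g⟫_ℂ).re +
        b * (⟪modeProj k f, yMul w (yShift s (modeProj k g))⟫_ℂ).im := by
    intro f g
    rw [inner_lyapunovOp]
    simp only [Complex.sub_re, Complex.mul_re, Complex.mul_im, Complex.I_re, Complex.I_im,
      Complex.ofReal_re, Complex.ofReal_im]
    ring
  have hself : ∀ f : L2Torus, (⟪f, lyapunovOp k b w s f⟫_ℂ).re = ‖modeProj k f‖ ^ 2 +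
        b * (⟪modeProj k f, yMul w (yShift s (modeProj k f))⟫_ℂ).im := by
    intro f
    rw [hform, inner_self_L2, Complex.ofReal_re]
  have hdiss : ∀ q ∈ (coefGraph κ ν U : Set (L2Torus × L2Torus)),
      (⟪q.1, lyapunovOp k b w s q.2⟫_ℂ).re + (⟪q.2, lyapunovOp k b w s q.1⟫_ℂ).re ≤
        -c * (⟪q.1, lyapunovOp k b w s q.1⟫_ℂ).re := by
    intro q hq
    obtain ⟨f₁, f₂, h₁, h₂, hg⟩ := exists_yDeriv_of_mem_coefGraph hν (modeProj_modeProj k q.1)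
      (modeProj_mem_coefGraph hq k)
    rw [hself, hform, hform]
    set f := modeProj k q.1
    set g := modeProj k q.2
    have e1 : (⟪f, g⟫_ℂ).re = -(κ * (k : ℝ) ^ 2) * ‖f‖ ^ 2 - ν * ‖f₁‖ ^ 2 := by
      rw [hg]; exact re_inner_mode hU h₁ h₂
    have e2 : (⟪g, f⟫_ℂ).re = (⟪f, g⟫_ℂ).re := inner_re_symm (𝕜 := ℂ) _ _
    have e3 := congrArg Complex.im (inner_commutator hU hw hUw (κ * (k : ℝ) ^ 2) ν k f f₂ hg)
    have e4 : (⟪f, yMul w (yShift s g)⟫_ℂ).im + (⟪g, yMul w (yShift s f)⟫_ℂ).im =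
        -(2 * (κ * (k : ℝ) ^ 2)) * (⟪f, yMul w (yShift s f)⟫_ℂ).im
        + ν * (⟪f, yMul w (yShift s f₂)⟫_ℂ + ⟪f₂, yMul w (yShift s f)⟫_ℂ).im
        - k * (⟪yMul w f, yMul w (yShift s f)⟫_ℂ).re := by
      rw [← Complex.add_im, e3, Complex.sub_im, Complex.add_im]
      congr 1
      · congr 1
        · have : (-(2 * ((κ * (k : ℝ) ^ 2 : ℝ) : ℂ))) = ((-(2 * (κ * (k : ℝ) ^ 2)) : ℝ) : ℂ) := by
            push_cast; ring
          rw [this, Complex.im_ofReal_mul]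
        · rw [Complex.im_ofReal_mul]
      · rw [mul_assoc, Complex.I_mul_im, ← Complex.ofReal_intCast, Complex.re_ofReal_mul]
    have e5 := le_re_inner_yMul_yShift (s := s) hd h₁
    have e6 := coercivity hd hm h₁
    have e7 := norm_inner_diffusion_le hw hr hd hd' s h₁ h₂
    have e8 : b * (⟪f, yMul w (yShift s f₂)⟫_ℂ + ⟪f₂, yMul w (yShift s f)⟫_ℂ).im ≤
        β * (2 * d * ‖f₁‖ ^ 2 + 2 * d' * (‖f‖ * ‖f₁‖)) := by
      refine (le_abs_self _).trans ?_
      rw [abs_mul, hab]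
      exact mul_le_mul_of_nonneg_left ((Complex.abs_im_le_norm _).trans e7) hβ
    have e9 := hmain ‖f‖ ‖f₁‖ (norm_nonneg _) (norm_nonneg _)
    have e10 := abs_le.1 (hbound f)
    have hk0 : 0 ≤ β * |(k : ℝ)| := by positivity
    have hbk : b * k = β * |(k : ℝ)| := by rw [hb, mul_assoc, hσk]
    have hK : 0 ≤ κ * (k : ℝ) ^ 2 := by positivity
    set Q := (⟪f, yMul w (yShift s f)⟫_ℂ).im
    set V := (⟪yMul w f, yMul w (yShift s f)⟫_ℂ).re
    set D := (⟪f, yMul w (yShift s f₂)⟫_ℂ + ⟪f₂, yMul w (yShift s f)⟫_ℂ).im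
    have e11 : (⟪f, g⟫_ℂ).re + b * (⟪f, yMul w (yShift s g)⟫_ℂ).im +
        ((⟪g, f⟫_ℂ).re + b * (⟪g, yMul w (yShift s f)⟫_ℂ).im) =
        -(2 * (κ * (k : ℝ) ^ 2)) * (‖f‖ ^ 2 + b * Q) - 2 * ν * ‖f₁‖ ^ 2 + ν * (b * D)
          - β * |(k : ℝ)| * V := by
      rw [e2, e1, ← hbk]
      linear_combination b * e4
    rw [e11]
    -- Diffusion in x is scalar on the mode, so it contributes a nonpositive multiple of the
    -- functional itself.
    have e12 : 0 ≤ κ * (k : ℝ) ^ 2 * (‖f‖ ^ 2 + b * Q) :=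
      mul_nonneg hK (by nlinarith [sq_nonneg ‖f‖])
    have e13 : ν * (b * D) ≤ ν * (β * (2 * d * ‖f₁‖ ^ 2 + 2 * d' * (‖f‖ * ‖f₁‖))) :=
      mul_le_mul_of_nonneg_left e8 hν.le
    -- Half of `coercivity` divided by 8: m/16 for the gain, and 9/2 + 1/2 = 5 for the loss.
    have e14 : β * |(k : ℝ)| * (m / 16 * ‖f‖ ^ 2 - 5 * (d ^ 2 * s ^ 2 * ‖f₁‖ ^ 2)) ≤
        β * |(k : ℝ)| * V := by
      refine mul_le_mul_of_nonneg_left ?_ hk0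
      linarith
    have e15 : c * (‖f‖ ^ 2 + b * Q) ≤ c * (3 / 2 * ‖f‖ ^ 2) :=
      mul_le_mul_of_nonneg_left (by linarith) hc
    linarith
  refine hS.norm_comp_projection_le (dense_domain_coefGraph κ ν U)
    (fun q hq => re_inner_nonpos_of_mem_coefGraph hκ hν hU hq) (P := modeProj k)
    (modeProj_modeProj k) (inner_modeProj k) (norm_modeProj_le k)
    (fun q hq => modeProj_mem_coefGraph hq k) hdiss (fun f => ?_) (fun f => ?_) ht
  · rw [hself]
    linarith [(abs_le.1 (hbound (modeProj k f))).1]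
  · rw [hself]
    linarith [(abs_le.1 (hbound (modeProj k f))).2]

end Decay

/-! ### Sines on the circle -/

section Sine

/-- The function `y ↦ sin (m y + φ)` on the circle. -/
def sinC (m : ℤ) (φ : ℝ) : C(Circ, ℂ) :=
  (Complex.exp (Complex.I * φ) / (2 * Complex.I)) • fourier m +
    (-Complex.exp (-(Complex.I * φ)) / (2 * Complex.I)) • fourier (-m)

theorem sinC_apply (m : ℤ) (φ y : ℝ) : sinC m φ (y : Circ) = (Real.sin (m * y + φ) : ℝ) := by
  have hpi : (π : ℂ) ≠ 0 := by exact_mod_cast pi_ne_zero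
  have h1 : ∀ n : ℤ, (fourier n (y : Circ) : ℂ) = Complex.exp (Complex.I * (n * y)) := by
    intro n
    rw [fourier_coe_apply]
    congr 1
    push_cast
    field_simp
  have h2 : Complex.exp (((m * y + φ : ℝ) : ℂ) * Complex.I) =
      Complex.exp (Complex.I * φ) * Complex.exp (Complex.I * (m * y)) := by
    rw [← Complex.exp_add]; congr 1; push_cast; ring
  have h3 : Complex.exp (-((m * y + φ : ℝ) : ℂ) * Complex.I) =
      Complex.exp (-(Complex.I * φ)) * Complex.exp (Complex.I * (((-m : ℤ) : ℂ) * y)) := by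
    rw [← Complex.exp_add]; congr 1; push_cast; ring
  rw [Complex.ofReal_sin, Complex.sin, h2, h3, sinC, ContinuousMap.add_apply,
    ContinuousMap.smul_apply, ContinuousMap.smul_apply, h1, h1, smul_eq_mul, smul_eq_mul]
  field_simp
  rw [Complex.I_sq]
  ring

theorem hasProductRule_sinC (m : ℤ) (φ : ℝ) :
    HasProductRule (sinC m φ) ((m : ℂ) • sinC m (φ + π / 2)) := by
  have h := ((hasProductRule_fourier m).smul (Complex.exp (Complex.I * φ) / (2 * Complex.I))).add
    ((hasProductRule_fourier (-m)).smul (-Complex.exp (-(Complex.I * φ)) / (2 * Complex.I)))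
  have e1 : Complex.exp (Complex.I * ((φ + π / 2 : ℝ) : ℂ)) =
      Complex.I * Complex.exp (Complex.I * φ) := by
    have : Complex.I * ((φ + π / 2 : ℝ) : ℂ) = Complex.I * φ + π / 2 * Complex.I := by
      push_cast; ring
    rw [this, Complex.exp_add, Complex.exp_pi_div_two_mul_I, mul_comm]
  have e2 : Complex.exp (-(Complex.I * ((φ + π / 2 : ℝ) : ℂ))) =
      -Complex.I * Complex.exp (-(Complex.I * φ)) := by
    have : -(Complex.I * ((φ + π / 2 : ℝ) : ℂ)) = -(Complex.I * φ) + -π / 2 * Complex.I := by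
      push_cast; ring
    rw [this, Complex.exp_add, Complex.exp_neg_pi_div_two_mul_I, mul_comm]
  have e3 : (m : ℂ) • sinC m (φ + π / 2) =
      (Complex.exp (Complex.I * φ) / (2 * Complex.I)) • (Complex.I * m) • fourier m +
      (-Complex.exp (-(Complex.I * φ)) / (2 * Complex.I)) •
        (Complex.I * ((-m : ℤ) : ℂ)) • fourier (-m) := by
    rw [sinC, e1, e2, smul_add, smul_smul, smul_smul, smul_smul, smul_smul]
    congr 2
    · ring
    · push_cast; ring
  rw [e3]
  exact h

theorem norm_sinC_le (m : ℤ) (φ : ℝ) : ‖sinC m φ‖ ≤ 1 := by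
  rw [ContinuousMap.norm_le _ zero_le_one]
  intro y
  induction y using QuotientAddGroup.induction_on with
  | H y =>
    have := sinC_apply m φ y
    rw [this, Complex.norm_real]
    exact Real.abs_sin_le_one _

/-- Among three equally spaced points of the circle, one has a sine bounded below. -/
theorem exists_abs_sin_ge (θ : ℝ) :
    ∃ j ∈ Finset.range 3, 4 / 5 ≤ |Real.sin (θ + j * (2 * π / 3))| := by
  by_contra! h
  have h0 := h 0 (by simp)
  have h1 := h 1 (by simp)
  have h2 := h 2 (by simp)
  have c1 : Real.cos (2 * π / 3) = -(1 / 2) := by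
    rw [show 2 * π / 3 = π - π / 3 by ring, Real.cos_pi_sub, Real.cos_pi_div_three]
  have s1 : Real.sin (2 * π / 3) = √3 / 2 := by
    rw [show 2 * π / 3 = π - π / 3 by ring, Real.sin_pi_sub, Real.sin_pi_div_three]
  have c2 : Real.cos (2 * (2 * π / 3)) = -(1 / 2) := by
    rw [Real.cos_two_mul, c1]; norm_num
  have s2 : Real.sin (2 * (2 * π / 3)) = -(√3 / 2) := by
    rw [Real.sin_two_mul, c1, s1]; ring
  push_cast at h0 h1 h2
  rw [zero_mul, add_zero, abs_lt] at h0
  rw [one_mul, Real.sin_add, c1, s1, abs_lt] at h1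
  rw [Real.sin_add, c2, s2, abs_lt] at h2
  set s := Real.sin θ
  set c := Real.cos θ
  have hsc : s ^ 2 + c ^ 2 = 1 := Real.sin_sq_add_cos_sq θ
  have h3 : √3 ^ 2 = 3 := Real.sq_sqrt (by norm_num)
  have h4 : 0 ≤ √3 := Real.sqrt_nonneg 3
  have h5 : 17 / 10 < √3 := by
    rw [Real.lt_sqrt (by norm_num)]; norm_num
  -- `√3 |c| + |s| < 8/5` contradicts `s² + c² = 1`, `|s| < 4/5`
  have hs : |s| < 4 / 5 := abs_lt.2 h0
  have hc : √3 * |c| + |s| < 8 / 5 := by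
    rcases abs_cases s with ⟨e, _⟩ | ⟨e, _⟩ <;> rcases abs_cases c with ⟨e', _⟩ | ⟨e', _⟩ <;>
      rw [e, e'] <;> linarith
  have hsc' : |s| ^ 2 + |c| ^ 2 = 1 := by rw [sq_abs, sq_abs, hsc]
  have hs0 := abs_nonneg s
  have hc0 := abs_nonneg c
  have hc2 : 17 / 10 * |c| + |s| < 8 / 5 := by nlinarith
  nlinarith

end Sine

/-! ### Nondegeneracy of the increments -/

section Increments

variable {a : ℕ → ℝ}

/-- The first increment, over a length `h = 2π / 3 ^ (M + 2)`, of the lacunary series: only the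
frequencies up to `3 ^ (M + 1)` survive. -/
def incr (a : ℕ → ℝ) (M : ℕ) (y : ℝ) : ℝ :=
  ∑ n ∈ Finset.range (M + 1), a (n + 1) *
    (Real.sin (3 ^ (n + 1) * y + 3 ^ (n + 1) * (2 * π / 3 ^ (M + 2))) - Real.sin (3 ^ (n + 1) * y))

/-- A centred second difference of a sine is -4 sin²(φ/2) times that sine, hence quadratically small
in the phase step φ at low frequencies. -/
theorem incr_sub_incr (a : ℕ → ℝ) (M : ℕ) (y : ℝ) :
    incr a M (y + 2 * π / 3 ^ (M + 2)) - incr a M y =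
      -∑ n ∈ Finset.range (M + 1), a (n + 1) *
        (4 * Real.sin (3 ^ (n + 1) * (2 * π / 3 ^ (M + 2)) / 2) ^ 2 *
          Real.sin (3 ^ (n + 1) * (y + 2 * π / 3 ^ (M + 2)))) := by
  rw [incr, incr, ← Finset.sum_sub_distrib, ← Finset.sum_neg_distrib]
  refine Finset.sum_congr rfl fun n _ => ?_
  set H := 2 * π / 3 ^ (M + 2)
  have key : ∀ θ φ : ℝ, Real.sin (θ + φ) - Real.sin θ - (Real.sin θ - Real.sin (θ - φ)) =
      -(4 * Real.sin (φ / 2) ^ 2 * Real.sin θ) := by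
    intro θ φ
    have h1 : Real.cos φ = 1 - 2 * Real.sin (φ / 2) ^ 2 := by
      have := Real.cos_two_mul' (φ / 2)
      rw [mul_div_cancel₀ _ (two_ne_zero)] at this
      rw [this]
      have := Real.sin_sq_add_cos_sq (φ / 2)
      linarith
    rw [Real.sin_add, Real.sin_sub, h1]
    ring
  have h := key (3 ^ (n + 1) * (y + H)) (3 ^ (n + 1) * H)
  have e : (3 : ℝ) ^ (n + 1) * (y + H) - 3 ^ (n + 1) * H = 3 ^ (n + 1) * y := by ring
  rw [e] at h
  have e' : (3 : ℝ) ^ (n + 1) * y + 3 ^ (n + 1) * H = 3 ^ (n + 1) * (y + H) := by ring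
  rw [e']
  linear_combination a (n + 1) * h

theorem abs_coeff_le (ha : ∀ n : ℕ, 1 ≤ n → |a n| ≤ 3 * |a (n + 1)|) {n M : ℕ} (h : n ≤ M) :
    |a (n + 1)| ≤ 3 ^ (M - n) * |a (M + 1)| := by
  induction M, h using Nat.le_induction with
  | base => simp
  | succ M h ih =>
    have h1 := ha (M + 1) (by omega)
    have h2 : M + 1 - n = (M - n) + 1 := by omega
    rw [h2, pow_succ, mul_assoc]
    exact ih.trans (mul_le_mul_of_nonneg_left h1 (by positivity))

/-- The top frequency has phase step 2π/3 and contributes at least 4 · (3/4) · (4/5) = 12/5 at one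
of three points. The lower ones contribute (4π²/9) ∑ 3^(-i) ≤ 111/50 over i ≥ 1, and 9/50 is what
remains. -/
theorem exists_abs_incr_sub_incr_ge (ha : ∀ n : ℕ, 1 ≤ n → |a n| ≤ 3 * |a (n + 1)|) (M : ℕ)
    (y : ℝ) : ∃ j ∈ Finset.range 3, 9 / 50 * |a (M + 1)| ≤
      |incr a M (y + j * (2 * π / 3 ^ (M + 2)) + 2 * π / 3 ^ (M + 2)) -
        incr a M (y + j * (2 * π / 3 ^ (M + 2)))| := by
  set H := 2 * π / 3 ^ (M + 2) with hH
  obtain ⟨j, hj, hsin⟩ := exists_abs_sin_ge (3 ^ (M + 1) * (y + H))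
  refine ⟨j, hj, ?_⟩
  rw [incr_sub_incr, abs_neg, ← hH, Finset.sum_range_succ]
  have htop : (3 : ℝ) ^ (M + 1) * H = 2 * π / 3 := by
    rw [hH, pow_succ 3 (M + 1)]; field_simp
  have harg : (3 : ℝ) ^ (M + 1) * (y + j * H + H) = 3 ^ (M + 1) * (y + H) + j * (2 * π / 3) := by
    rw [← htop]; ring
  have hsin3 : Real.sin (3 ^ (M + 1) * H / 2) ^ 2 = 3 / 4 := by
    rw [htop, show 2 * π / 3 / 2 = π / 3 by ring, Real.sin_pi_div_three, div_pow,
      Real.sq_sqrt (by norm_num)]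
    norm_num
  have hlow : 12 / 5 * |a (M + 1)| ≤ |a (M + 1) * (4 * Real.sin (3 ^ (M + 1) * H / 2) ^ 2 *
      Real.sin (3 ^ (M + 1) * (y + j * H + H)))| := by
    rw [hsin3, harg, abs_mul, abs_mul, abs_of_nonneg (by norm_num : (0 : ℝ) ≤ 4 * (3 / 4))]
    nlinarith [abs_nonneg (a (M + 1))]
  have hrest : |∑ n ∈ Finset.range M, a (n + 1) * (4 * Real.sin (3 ^ (n + 1) * H / 2) ^ 2 *
      Real.sin (3 ^ (n + 1) * (y + j * H + H)))| ≤ 111 / 50 * |a (M + 1)| := by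
    refine (Finset.abs_sum_le_sum_abs _ _).trans ?_
    have hterm : ∀ n ∈ Finset.range M, |a (n + 1) * (4 * Real.sin (3 ^ (n + 1) * H / 2) ^ 2 *
        Real.sin (3 ^ (n + 1) * (y + j * H + H)))| ≤
          4 * π ^ 2 / 9 * |a (M + 1)| * (1 / 3) ^ (M - n) := by
      intro n hn
      have hnM : n ≤ M := (Finset.mem_range.1 hn).le
      have h1 := abs_coeff_le ha hnM
      have h2 : 3 ^ (n + 1) * H = 2 * π / 3 * (1 / 3) ^ (M - n) := by
        have : (3 : ℝ) ^ (M + 2) = 3 ^ (n + 1) * 3 * 3 ^ (M - n) := by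
          rw [← pow_succ, ← pow_add]; congr 1; omega
        rw [hH, this, one_div, inv_pow]
        field_simp
      have h3 : 4 * Real.sin (3 ^ (n + 1) * H / 2) ^ 2 ≤ (3 ^ (n + 1) * H) ^ 2 := by
        have h4 : |Real.sin (3 ^ (n + 1) * H / 2)| ≤ |3 ^ (n + 1) * H / 2| := Real.abs_sin_le_abs
        have h5 := sq_le_sq.2 h4
        rw [div_pow] at h5
        linarith
      rw [abs_mul, abs_mul, abs_of_nonneg (by positivity :
        0 ≤ 4 * Real.sin (3 ^ (n + 1) * H / 2) ^ 2)]
      calc _ ≤ (3 ^ (M - n) * |a (M + 1)|) * ((3 ^ (n + 1) * H) ^ 2 * 1) := by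
            gcongr
            exact Real.abs_sin_le_one _
        _ = 4 * π ^ 2 / 9 * |a (M + 1)| * (1 / 3) ^ (M - n) := by
            rw [h2, one_div, inv_pow]
            field_simp
            ring
    refine (Finset.sum_le_sum hterm).trans ?_
    rw [← Finset.mul_sum]
    have hgeom : ∑ n ∈ Finset.range M, (1 / 3 : ℝ) ^ (M - n) ≤ 1 / 2 := by
      have h1 : ∑ n ∈ Finset.range M, (1 / 3 : ℝ) ^ (M - n) =
          ∑ n ∈ Finset.range M, (1 / 3 : ℝ) ^ (n + 1) := by
        rw [← Finset.sum_range_reflect]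
        refine Finset.sum_congr rfl fun n hn => ?_
        have := Finset.mem_range.1 hn
        congr 1; omega
      have h2 : ∀ K : ℕ, ∑ n ∈ Finset.range K, (1 / 3 : ℝ) ^ (n + 1) =
          1 / 2 - 1 / 2 * (1 / 3) ^ K := by
        intro K
        induction K with
        | zero => simp
        | succ K ih => rw [Finset.sum_range_succ, ih]; ring
      rw [h1, h2]
      have : (0 : ℝ) ≤ 1 / 2 * (1 / 3) ^ M := by positivity
      linarith
    have hpi : π ^ 2 ≤ 999 / 100 := by
      have h1 := Real.pi_lt_d2
      have h2 := Real.pi_pos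
      nlinarith
    calc 4 * π ^ 2 / 9 * |a (M + 1)| * ∑ n ∈ Finset.range M, (1 / 3 : ℝ) ^ (M - n)
        ≤ 4 * (999 / 100) / 9 * |a (M + 1)| * (1 / 2) := by gcongr
      _ = 111 / 50 * |a (M + 1)| := by ring
  have := abs_sub_abs_le_abs_sub (a (M + 1) * (4 * Real.sin (3 ^ (M + 1) * H / 2) ^ 2 *
      Real.sin (3 ^ (M + 1) * (y + j * H + H))))
      (-∑ n ∈ Finset.range M, a (n + 1) * (4 * Real.sin (3 ^ (n + 1) * H / 2) ^ 2 *
      Real.sin (3 ^ (n + 1) * (y + j * H + H))))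
  rw [abs_neg, sub_neg_eq_add, add_comm (a (M + 1) * _)] at this
  linarith

/-- Nondegeneracy of the first increment. -/
theorem sum_incr_sq_ge (ha : ∀ n : ℕ, 1 ≤ n → |a n| ≤ 3 * |a (n + 1)|) (M : ℕ) (y : ℝ) :
    |a (M + 1)| ^ 2 / 100 ≤
      ∑ j ∈ Finset.range 4, incr a M (y + j * (2 * π / 3 ^ (M + 2))) ^ 2 := by
  obtain ⟨j, hj, h⟩ := exists_abs_incr_sub_incr_ge ha M y
  set H := 2 * π / 3 ^ (M + 2)
  have h1 : y + j * H + H = y + ((j + 1 : ℕ) : ℝ) * H := by push_cast; ring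
  rw [h1] at h
  set p := incr a M (y + ((j + 1 : ℕ) : ℝ) * H) with hp
  set q := incr a M (y + j * H) with hq
  have h2 : p ^ 2 + q ^ 2 ≤ ∑ j ∈ Finset.range 4, incr a M (y + j * H) ^ 2 := by
    have hsub : ({j + 1, j} : Finset ℕ) ⊆ Finset.range 4 := by
      have := Finset.mem_range.1 hj
      intro i hi
      simp only [Finset.mem_insert, Finset.mem_singleton] at hi
      rw [Finset.mem_range]
      omega
    have := Finset.sum_le_sum_of_subset_of_nonneg (f := fun j : ℕ => incr a M (y + j * H) ^ 2) hsub
      (fun _ _ _ => sq_nonneg _)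
    rwa [Finset.sum_pair (by omega)] at this
  have h3 : (9 / 50 * |a (M + 1)|) ^ 2 ≤ (p - q) ^ 2 := by
    rw [← sq_abs (p - q)]
    gcongr
  -- p² + q² ≥ (p - q)²/2, and (9/50)²/2 > 1/100.
  nlinarith [sq_nonneg (p + q), sq_nonneg (|a (M + 1)|)]

end Increments

/-! ### The lacunary profile and its increment -/

section Profile

variable {a : ℕ → ℝ} {r C₀ : ℝ} {u : Circ → ℝ}

/-- The lacunary series defines a continuous function on the circle. -/
theorem exists_continuous_profile (hr0 : 0 ≤ r) (hr1 : r < 1)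
    (ha : ∀ n : ℕ, 1 ≤ n → |a n| ≤ C₀ * r ^ n)
    (hu : ∀ y : ℝ,
      HasSum (fun n : ℕ => a (n + 1) * Real.sin ((3 : ℝ) ^ (n + 1) * y)) (u (y : Circ))) :
    ∃ U : C(Circ, ℂ), ∀ y, U y = u y := by
  have hsum : Summable fun n : ℕ => (a (n + 1) : ℂ) • sinC (3 ^ (n + 1)) 0 := by
    have h1 : Summable fun n : ℕ => C₀ * r ^ (n + 1) :=
      ((summable_nat_add_iff 1).2 (summable_geometric_of_lt_one hr0 hr1)).mul_left C₀
    refine Summable.of_norm_bounded h1 fun n => ?_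
    rw [norm_smul, Complex.norm_real, Real.norm_eq_abs]
    calc |a (n + 1)| * ‖sinC (3 ^ (n + 1)) 0‖ ≤ |a (n + 1)| * 1 := by
          gcongr; exact norm_sinC_le _ _
      _ ≤ C₀ * r ^ (n + 1) := by rw [mul_one]; exact ha _ (by omega)
  refine ⟨∑' n, (a (n + 1) : ℂ) • sinC (3 ^ (n + 1)) 0, fun y => ?_⟩
  induction y using QuotientAddGroup.induction_on with
  | H y =>
    have h2 := (ContinuousMap.evalCLM ℂ (y : Circ)).hasSum hsum.hasSum
    have h3 : HasSum (fun n : ℕ => ((a (n + 1) * Real.sin ((3 : ℝ) ^ (n + 1) * y) : ℝ) : ℂ))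
        (u (y : Circ) : ℂ) := Complex.hasSum_ofReal.2 (hu y)
    refine h2.unique (h3.congr_fun fun n => ?_)
    have h4 := sinC_apply (3 ^ (n + 1)) 0 y
    simp only [ContinuousMap.evalCLM_apply, ContinuousMap.smul_apply, smul_eq_mul, h4]
    push_cast
    rw [add_zero]

theorem star_eq_self_of_real {U : C(Circ, ℂ)} (hU : ∀ y, U y = u y) : star U = U := by
  ext y
  rw [ContinuousMap.star_apply, hU, RCLike.star_def, Complex.conj_ofReal]

/-- For n > M the shift moves the phase 3^(n+1) y by a multiple of 2π, so the tail of the series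
cancels. -/
theorem increment_eq_incr (hu : ∀ y : ℝ,
      HasSum (fun n : ℕ => a (n + 1) * Real.sin ((3 : ℝ) ^ (n + 1) * y)) (u (y : Circ)))
    (M : ℕ) (y : ℝ) :
    u ((y + 2 * π / 3 ^ (M + 2) : ℝ) : Circ) - u (y : Circ) = incr a M y := by
  refine ((hu _).sub (hu y)).unique ?_
  have h := hasSum_sum_of_ne_finset_zero (s := Finset.range (M + 1))
    (f := fun n : ℕ => a (n + 1) * Real.sin ((3 : ℝ) ^ (n + 1) * (y + 2 * π / 3 ^ (M + 2))) -
      a (n + 1) * Real.sin ((3 : ℝ) ^ (n + 1) * y)) (L := .unconditional ℕ) (fun n hn => by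
    rw [Finset.mem_range, not_lt] at hn
    have h1 : (3 : ℝ) ^ (n + 1) * (y + 2 * π / 3 ^ (M + 2)) =
        3 ^ (n + 1) * y + ((3 ^ (n - (M + 1)) : ℕ) : ℝ) * (2 * π) := by
      have : (3 : ℝ) ^ (n + 1) = 3 ^ (n - (M + 1)) * 3 ^ (M + 2) := by
        rw [← pow_add]; congr 1; omega
      rw [mul_add, this]
      push_cast
      field_simp
    rw [h1, Real.sin_add_nat_mul_two_pi, sub_self])
  have he : incr a M y = ∑ n ∈ Finset.range (M + 1),
      (a (n + 1) * Real.sin ((3 : ℝ) ^ (n + 1) * (y + 2 * π / 3 ^ (M + 2))) -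
        a (n + 1) * Real.sin ((3 : ℝ) ^ (n + 1) * y)) :=
    Finset.sum_congr rfl fun n _ => by rw [mul_add, mul_sub]
  rw [he]
  exact h

theorem sum_pow_succ_le {x : ℝ} (hx : 1 < x) (K : ℕ) :
    ∑ n ∈ Finset.range K, x ^ (n + 1) ≤ x ^ (K + 1) / (x - 1) := by
  have h0 : 0 < x - 1 := by linarith
  rw [le_div_iff₀ h0]
  induction K with
  | zero => simp; linarith
  | succ K ih =>
    rw [Finset.sum_range_succ, add_mul]
    calc _ ≤ x ^ (K + 1) + x ^ (K + 1) * (x - 1) := by linarith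
      _ = x ^ (K + 1 + 1) := by ring

/-- Size of the increment of the lacunary series and of its derivative, and nondegeneracy. -/
theorem exists_increment (hr : 1 < 3 * r) (ha : ∀ n : ℕ, 1 ≤ n → |a n| ≤ C₀ * r ^ n)
    (ha_lower : ∀ n : ℕ, 1 ≤ n → r ^ n ≤ |a n|)
    (ha_ratio : ∀ n : ℕ, 1 ≤ n → |a n| ≤ 3 * |a (n + 1)|)
    (hu : ∀ y : ℝ,
      HasSum (fun n : ℕ => a (n + 1) * Real.sin ((3 : ℝ) ^ (n + 1) * y)) (u (y : Circ)))
    {U : C(Circ, ℂ)} (hU : ∀ y, U y = u y) (M : ℕ) :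
    ∃ w w' : C(Circ, ℂ), w = translate U ((2 * π / 3 ^ (M + 2) : ℝ) : Circ) - U ∧
      HasProductRule w w' ∧
      (∀ y, ‖w y‖ ≤ 2 * π * C₀ / (3 * r - 1) * r ^ (M + 2)) ∧
      (∀ y, ‖w' y‖ ≤ 2 * π * C₀ / (9 * r - 1) * (3 * r) ^ (M + 2)) ∧
      ∀ y : Circ, (r ^ (M + 1)) ^ 2 / 100 ≤ ∑ j ∈ Finset.range 4,
        ‖w (y + ((j * (2 * π / 3 ^ (M + 2)) : ℝ) : Circ))‖ ^ 2 := by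
  have hr0 : 0 < r := by linarith
  have hC₀ : 0 ≤ C₀ := by
    have := (abs_nonneg _).trans (ha 1 le_rfl)
    rw [pow_one] at this
    exact nonneg_of_mul_nonneg_left this hr0
  set H := 2 * π / 3 ^ (M + 2) with hH
  have hH0 : 0 ≤ H := by positivity
  have hpow : ∀ x : ℝ, H * (3 * x) ^ (M + 2) = 2 * π * x ^ (M + 2) := fun x => by
    rw [hH, mul_pow]; field_simp
  set w : C(Circ, ℂ) := ∑ n ∈ Finset.range (M + 1), (a (n + 1) : ℂ) •
    (sinC (3 ^ (n + 1)) (3 ^ (n + 1) * H) + (-1 : ℂ) • sinC (3 ^ (n + 1)) 0) with hw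
  set w' : C(Circ, ℂ) := ∑ n ∈ Finset.range (M + 1), (a (n + 1) : ℂ) •
    (((3 ^ (n + 1) : ℤ) : ℂ) • sinC (3 ^ (n + 1)) (3 ^ (n + 1) * H + π / 2) +
      (-1 : ℂ) • ((3 ^ (n + 1) : ℤ) : ℂ) • sinC (3 ^ (n + 1)) (0 + π / 2)) with hw'
  have hwy : ∀ y : ℝ, w (y : Circ) = incr a M y := by
    intro y
    rw [hw, incr]
    simp only [ContinuousMap.coe_sum, Finset.sum_apply, ContinuousMap.smul_apply,
      ContinuousMap.add_apply, smul_eq_mul]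
    push_cast
    refine Finset.sum_congr rfl fun n _ => ?_
    have h1 := sinC_apply (3 ^ (n + 1)) (3 ^ (n + 1) * H) y
    have h2 := sinC_apply (3 ^ (n + 1)) 0 y
    rw [h1, h2, hH]
    push_cast
    rw [add_zero]
    ring
  have hwy' : ∀ y : ℝ, w' (y : Circ) = ((∑ n ∈ Finset.range (M + 1), a (n + 1) * (3 ^ (n + 1) *
      (Real.sin (3 ^ (n + 1) * y + (3 ^ (n + 1) * H + π / 2)) -
        Real.sin (3 ^ (n + 1) * y + (0 + π / 2)))) : ℝ) : ℂ) := by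
    intro y
    rw [hw']
    simp only [ContinuousMap.coe_sum, Finset.sum_apply, ContinuousMap.smul_apply,
      ContinuousMap.add_apply, smul_eq_mul]
    rw [Complex.ofReal_sum]
    refine Finset.sum_congr rfl fun n _ => ?_
    have h1 := sinC_apply (3 ^ (n + 1)) (3 ^ (n + 1) * H + π / 2) y
    have h2 := sinC_apply (3 ^ (n + 1)) (0 + π / 2) y
    rw [h1, h2]
    push_cast
    ring
  refine ⟨w, w', ?_, ?_, ?_, ?_, ?_⟩
  · ext y
    induction y using QuotientAddGroup.induction_on with
    | H y =>
      have h1 := increment_eq_incr hu M y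
      have h2 := hwy y
      have h3 : (translate U (H : Circ) - U) (y : Circ) =
          ((u ((y + H : ℝ) : Circ) - u (y : Circ) : ℝ) : ℂ) := by
        rw [ContinuousMap.sub_apply, translate_apply, hU, hU, AddCircle.coe_add]
        push_cast
        rfl
      rw [← hH] at h1
      rw [h1] at h3
      exact h2.trans h3.symm
  · exact HasProductRule.sum fun n _ => ((hasProductRule_sinC _ _).add
      ((hasProductRule_sinC _ _).smul _)).smul _
  · intro y
    induction y using QuotientAddGroup.induction_on with
    | H y =>
      have h1 := hwy y
      rw [h1, Complex.norm_real, Real.norm_eq_abs, incr, ← hH]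
      refine (Finset.abs_sum_le_sum_abs _ _).trans ?_
      -- Each sine difference is at most its phase step. Since 3r > 1, that is α < 1, the geometric
      -- sum is governed by its top term.
      have hterm : ∀ n ∈ Finset.range (M + 1), |a (n + 1) *
          (Real.sin (3 ^ (n + 1) * y + 3 ^ (n + 1) * H) - Real.sin (3 ^ (n + 1) * y))| ≤
          C₀ * H * (3 * r) ^ (n + 1) := by
        intro n _
        have h2 := Real.abs_sin_sub_sin_le (3 ^ (n + 1) * y + 3 ^ (n + 1) * H) (3 ^ (n + 1) * y)
        rw [add_sub_cancel_left, abs_of_nonneg (by positivity : (0 : ℝ) ≤ 3 ^ (n + 1) * H)] at h2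
        rw [abs_mul]
        calc _ ≤ (C₀ * r ^ (n + 1)) * (3 ^ (n + 1) * H) := by
              gcongr; exact ha _ (by omega)
          _ = _ := by rw [mul_pow]; ring
      refine (Finset.sum_le_sum hterm).trans ?_
      rw [← Finset.mul_sum]
      have h3 := sum_pow_succ_le hr (M + 1)
      calc _ ≤ C₀ * H * ((3 * r) ^ (M + 2) / (3 * r - 1)) := by gcongr
        _ = C₀ * (H * (3 * r) ^ (M + 2)) / (3 * r - 1) := by ring
        _ = _ := by rw [hpow]; ring
  · intro y
    induction y using QuotientAddGroup.induction_on with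
    | H y =>
      have h1 := hwy' y
      rw [h1, Complex.norm_real, Real.norm_eq_abs]
      refine (Finset.abs_sum_le_sum_abs _ _).trans ?_
      have hterm : ∀ n ∈ Finset.range (M + 1), |a (n + 1) * (3 ^ (n + 1) *
          (Real.sin (3 ^ (n + 1) * y + (3 ^ (n + 1) * H + π / 2)) -
            Real.sin (3 ^ (n + 1) * y + (0 + π / 2))))| ≤ C₀ * H * (3 * (3 * r)) ^ (n + 1) := by
        intro n _
        have h2 := Real.abs_sin_sub_sin_le (3 ^ (n + 1) * y + (3 ^ (n + 1) * H + π / 2))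
          (3 ^ (n + 1) * y + (0 + π / 2))
        rw [show (3 : ℝ) ^ (n + 1) * y + (3 ^ (n + 1) * H + π / 2) -
          (3 ^ (n + 1) * y + (0 + π / 2)) = 3 ^ (n + 1) * H by ring,
          abs_of_nonneg (by positivity : (0 : ℝ) ≤ 3 ^ (n + 1) * H)] at h2
        rw [abs_mul, abs_mul, abs_of_nonneg (by positivity : (0 : ℝ) ≤ 3 ^ (n + 1))]
        calc _ ≤ (C₀ * r ^ (n + 1)) * (3 ^ (n + 1) * (3 ^ (n + 1) * H)) := by
              gcongr; exact ha _ (by omega)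
          _ = _ := by rw [mul_pow, mul_pow]; ring
      refine (Finset.sum_le_sum hterm).trans ?_
      rw [← Finset.mul_sum]
      have h3 := sum_pow_succ_le (by linarith : 1 < 3 * (3 * r)) (M + 1)
      have h9 : (0 : ℝ) < 9 * r - 1 := by linarith
      have h9' : 3 * (3 * r) - 1 = 9 * r - 1 := by ring
      calc _ ≤ C₀ * H * ((3 * (3 * r)) ^ (M + 2) / (3 * (3 * r) - 1)) := by gcongr
        _ = C₀ * (H * (3 * (3 * r)) ^ (M + 2)) / (9 * r - 1) := by rw [h9']; ring
        _ = _ := by rw [hpow]; ring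
  · intro y
    induction y using QuotientAddGroup.induction_on with
    | H y =>
      have h1 := sum_incr_sq_ge ha_ratio M y
      rw [← hH] at h1
      have h2 : (r ^ (M + 1)) ^ 2 / 100 ≤ |a (M + 1)| ^ 2 / 100 := by
        gcongr; exact ha_lower _ (by omega)
      refine (h2.trans h1).trans (le_of_eq (Finset.sum_congr rfl fun j _ => ?_))
      have h3 := hwy (y + j * H)
      rw [AddCircle.coe_add] at h3
      rw [← sq_abs, ← Real.norm_eq_abs, ← Complex.norm_real, ← h3]

end Profile

/-! ### Balancing the constants -/

section EnhancedDissipation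

/-- The coercivity estimate in rescaled variables. -/
theorem scaled_dissipation {lam ν K δ p d d' m D₁ D₂ b s : ℝ} (hlam : 0 < lam) (hδ : 0 < δ)
    (hp : 0 < p) (hK : K * p = lam) (hν : ν = lam * δ ^ 2) (hK0 : 0 ≤ K)
    (hd : d = D₁ * p) (hd' : d' = D₂ * p / δ) (hm : m = p ^ 2 / 8100) (hs0 : 0 ≤ s)
    (hs : s ≤ 7 * δ) (hb : 0 ≤ b)
    (hb1 : b * (2 * D₁ + 245 * D₁ ^ 2 + 259200 * D₂ ^ 2) ≤ 2) {x z : ℝ} :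
    -2 * ν * z ^ 2 + b / p * (ν * (2 * d * z ^ 2 + 2 * d' * (x * z))
      - K * m / 16 * x ^ 2 + 5 * K * (d ^ 2 * s ^ 2 * z ^ 2)) ≤
        -(3 / 2 * (lam * b / 388800)) * x ^ 2 := by
  have hs2 : s ^ 2 ≤ 49 * δ ^ 2 := by nlinarith
  have h1 : 5 * K * (d ^ 2 * s ^ 2 * z ^ 2) ≤ 5 * K * (d ^ 2 * (49 * δ ^ 2) * z ^ 2) := by gcongr
  have h2 : b / p * (ν * (2 * d * z ^ 2 + 2 * d' * (x * z))
      - K * m / 16 * x ^ 2 + 5 * K * (d ^ 2 * s ^ 2 * z ^ 2)) ≤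
      b / p * (ν * (2 * d * z ^ 2 + 2 * d' * (x * z))
      - K * m / 16 * x ^ 2 + 5 * K * (d ^ 2 * (49 * δ ^ 2) * z ^ 2)) := by gcongr
  have h3 : b / p * (ν * (2 * d * z ^ 2 + 2 * d' * (x * z))
      - K * m / 16 * x ^ 2 + 5 * K * (d ^ 2 * (49 * δ ^ 2) * z ^ 2)) =
      lam * (b * (2 * D₁ * (δ * z) ^ 2 + 2 * D₂ * (x * (δ * z)) - x ^ 2 / 129600
        + 245 * D₁ ^ 2 * (δ * z) ^ 2)) := by
    rw [hν, hd, hd', hm, ← hK]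
    field_simp
    ring
  -- Young's inequality, weighted to spend exactly half of the gain x²/129600, where 129600 = 16 ·
  -- 8100.
  have h4 : 2 * D₂ * (x * (δ * z)) ≤ x ^ 2 / 259200 + 259200 * D₂ ^ 2 * (δ * z) ^ 2 := by
    nlinarith [sq_nonneg (x / 259200 - D₂ * (δ * z))]
  have h5 : b * (2 * D₁ * (δ * z) ^ 2 + 2 * D₂ * (x * (δ * z)) - x ^ 2 / 129600
        + 245 * D₁ ^ 2 * (δ * z) ^ 2) ≤ 2 * (δ * z) ^ 2 - b * x ^ 2 / 259200 := by
    have h6 := mul_le_mul_of_nonneg_left h4 hb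
    have h7 := mul_le_mul_of_nonneg_right hb1 (sq_nonneg (δ * z))
    linarith
  have h6 := mul_le_mul_of_nonneg_left h5 hlam.le
  rw [hν] at h2 h3 ⊢
  linarith

end EnhancedDissipation

end ShearFlow

end

/-! ### Choice of the scale and conclusion -/

theorem lemma5p3
    (α C₀ : ℝ) (hα₀ : 0 < α) (hα₁ : α < 1) (hC₀ : 1 < C₀)
    (a : ℕ → ℝ)
    (ha_lower : ∀ n : ℕ, 1 ≤ n → (3 : ℝ) ^ (-((n : ℝ) * α)) ≤ |a n|)
    (ha_upper : ∀ n : ℕ, 1 ≤ n → |a n| ≤ C₀ * (3 : ℝ) ^ (-((n : ℝ) * α)))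
    (ha_ratio : ∀ n : ℕ, 1 ≤ n → 1 ≤ |a n| / |a (n + 1)| ∧ |a n| / |a (n + 1)| ≤ 3)
    (u : ShearFlow.Circ → ℝ)
    (hu : ∀ y : ℝ,
      HasSum (fun n : ℕ => a (n + 1) * Real.sin ((3 : ℝ) ^ (n + 1) * y)) (u (y : ShearFlow.Circ))) :
    -- the semigroups `S_ν` and `R_ν` exist
    (∀ ν : ℝ, 0 < ν →
      (∃ S : ℝ → ShearFlow.L2Torus →L[ℂ] ShearFlow.L2Torus,
        ShearFlow.IsSemigroupGeneratedBy S (ShearFlow.driftDiffusionGraph ν u)) ∧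
      (∃ R : ℝ → ShearFlow.L2Torus →L[ℂ] ShearFlow.L2Torus,
        ShearFlow.IsSemigroupGeneratedBy R (ShearFlow.hypoellipticGraph ν u))) ∧
    -- and obey the enhanced dissipation bounds
    ∃ ε C : ℝ, 0 < ε ∧ 0 < C ∧
      ∀ ν : ℝ, 0 < ν → ∀ k : ℤ, k ≠ 0 → ν * |(k : ℝ)|⁻¹ ≤ 1 / 2 →
        (∀ S : ℝ → ShearFlow.L2Torus →L[ℂ] ShearFlow.L2Torus,
          ShearFlow.IsSemigroupGeneratedBy S (ShearFlow.driftDiffusionGraph ν u) →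
          ∀ t : ℝ, 0 ≤ t →
            ‖(S t).comp (ShearFlow.modeProj k)‖ ≤
              C * Real.exp (-(ε * (ν ^ (α / (α + 2)) * |(k : ℝ)| ^ (2 / (α + 2))) * t))) ∧
        (∀ R : ℝ → ShearFlow.L2Torus →L[ℂ] ShearFlow.L2Torus,
          ShearFlow.IsSemigroupGeneratedBy R (ShearFlow.hypoellipticGraph ν u) →
          ∀ t : ℝ, 0 ≤ t →
            ‖(R t).comp (ShearFlow.modeProj k)‖ ≤
              C * Real.exp (-(ε * (ν ^ (α / (α + 2)) * |(k : ℝ)| ^ (2 / (α + 2))) * t))) := by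
  set r : ℝ := (3 : ℝ) ^ (-α) with hr
  have hr0 : 0 < r := by positivity
  have hr1 : r < 1 := Real.rpow_lt_one_of_one_lt_of_neg (by norm_num) (by linarith)
  have h3r : 1 < 3 * r := by
    have h1 : (3 : ℝ) * r = 3 ^ (1 - α) := by
      rw [hr, sub_eq_add_neg, Real.rpow_add (by norm_num), Real.rpow_one]
    rw [h1]
    exact Real.one_lt_rpow (by norm_num) (by linarith)
  have hrn : ∀ n : ℕ, (3 : ℝ) ^ (-((n : ℝ) * α)) = r ^ n := fun n => by
    rw [hr, ← Real.rpow_natCast, ← Real.rpow_mul (by norm_num)]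
    congr 1; ring
  simp only [hrn] at ha_lower ha_upper
  have hratio : ∀ n : ℕ, 1 ≤ n → |a n| ≤ 3 * |a (n + 1)| := fun n hn => by
    have h1 : 0 < |a (n + 1)| := (pow_pos hr0 (n + 1)).trans_le (ha_lower (n + 1) (by omega))
    exact (div_le_iff₀ h1).1 (ha_ratio n hn).2
  obtain ⟨U, hU⟩ := ShearFlow.exists_continuous_profile hr0.le hr1 ha_upper hu
  have hUs := ShearFlow.star_eq_self_of_real hU
  refine ⟨fun ν hν => ?_, ?_⟩
  · rw [ShearFlow.driftDiffusionGraph, ShearFlow.hypoellipticGraph,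
      ← ShearFlow.coe_coefGraph ν ν hU, ← ShearFlow.coe_coefGraph 0 ν hU]
    exact ⟨(ShearFlow.isMaxDissipative_coefGraph hν.le hν hUs).exists_isSemigroupGeneratedBy,
      (ShearFlow.isMaxDissipative_coefGraph le_rfl hν hUs).exists_isSemigroupGeneratedBy⟩
  have h9r : 0 < 9 * r - 1 := by linarith
  have h3r' : 0 < 3 * r - 1 := by linarith
  set D₁ : ℝ := 2 * π * C₀ / (3 * r - 1) with hD₁
  -- The factor 9 pays for replacing the grid scale q by δ ≤ 9q in the bound for w'.
  set D₂ : ℝ := 9 * (2 * π * C₀ / (9 * r - 1)) with hD₂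
  have hD₁0 : 0 ≤ D₁ := by positivity
  have hD₂0 : 0 ≤ D₂ := by positivity
  -- Small enough for the errors in `scaled_dissipation` and for b D₁ ≤ 1/2, uniformly in ν and k.
  set b : ℝ := 1 / (1 + 2 * D₁ + 245 * D₁ ^ 2 + 259200 * D₂ ^ 2) with hb
  have hb0 : 0 < b := by positivity
  have hbsum : b * (1 + 2 * D₁ + 245 * D₁ ^ 2 + 259200 * D₂ ^ 2) = 1 := by
    rw [hb]; field_simp
  refine ⟨b / 777600, 2, by positivity, two_pos, fun ν hν k hk hνk => ?_⟩
  have hk0 : 0 < |(k : ℝ)| := abs_pos.2 (by exact_mod_cast hk)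
  have hx0 : 0 < ν / |(k : ℝ)| := by positivity
  have hx1 : ν / |(k : ℝ)| < 1 := by rw [div_eq_mul_inv]; linarith
  have hα2 : 0 < α + 2 := by linarith
  -- The length at which diffusion and transport balance: ν = lam δ² and |k| δ^α = lam.
  set δ : ℝ := (ν / |(k : ℝ)|) ^ (1 / (α + 2)) with hδ
  have hδ0 : 0 < δ := by positivity
  have hδ1 : δ ≤ 1 := Real.rpow_le_one hx0.le hx1.le (by positivity)
  set p : ℝ := δ ^ α with hp
  have hp0 : 0 < p := by positivity
  set lam : ℝ := ν ^ (α / (α + 2)) * |(k : ℝ)| ^ (2 / (α + 2)) with hlam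
  have hlam0 : 0 < lam := by positivity
  have hKp : |(k : ℝ)| * p = lam := by
    have h1 : p = ν ^ (α / (α + 2)) / |(k : ℝ)| ^ (α / (α + 2)) := by
      rw [hp, hδ, ← Real.rpow_mul hx0.le, Real.div_rpow hν.le hk0.le]
      congr 2 <;> ring
    have h2 : |(k : ℝ)| = |(k : ℝ)| ^ (α / (α + 2)) * |(k : ℝ)| ^ (2 / (α + 2)) := by
      rw [← Real.rpow_add hk0, ← add_div, div_self hα2.ne', Real.rpow_one]
    have h3 : |(k : ℝ)| ^ (α / (α + 2)) ≠ 0 := by positivity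
    rw [h1, hlam, mul_div_assoc', div_eq_iff h3]
    nth_rewrite 1 [h2]
    ring
  have hνlam : ν = lam * δ ^ 2 := by
    have h1 : p * δ ^ 2 = ν / |(k : ℝ)| := by
      rw [hp, ← Real.rpow_natCast, ← Real.rpow_add hδ0, hδ, ← Real.rpow_mul hx0.le]
      push_cast
      rw [one_div, inv_mul_cancel₀ hα2.ne', Real.rpow_one]
    rw [← hKp, mul_assoc, h1]
    field_simp
  -- M is chosen with 3^(-(M+1)) < δ ≤ 3^(-M), so the grid scale q = 3^(-(M+2)) satisfies q ≤ δ ≤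
  -- 9q.
  obtain ⟨M, hM1, hM2⟩ := exists_nat_pow_near_of_lt_one hδ0 hδ1 (by norm_num : (0 : ℝ) < 1 / 3)
    (by norm_num)
  set q : ℝ := (1 / 3) ^ (M + 2) with hq
  have hq0 : 0 < q := by positivity
  have hqδ : q ≤ δ := by
    have : q = (1 / 3) ^ (M + 1) * (1 / 3) := by rw [hq, pow_succ]
    rw [this]
    have h0 : (0 : ℝ) < (1 / 3) ^ (M + 1) := by positivity
    linarith
  have hδq : δ ≤ 9 * q := by
    have : q = (1 / 3) ^ M * (1 / 9) := by rw [hq, pow_add]; norm_num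
    rw [this]; linarith
  have hrq : r ^ (M + 2) = q ^ α := by
    rw [hr, hq, one_div, ← Real.rpow_natCast, ← Real.rpow_natCast, ← Real.rpow_mul (by norm_num),
      ← Real.rpow_mul (by norm_num), Real.inv_rpow (by norm_num), ← Real.rpow_neg (by norm_num)]
    congr 1; ring
  have hrp : r ^ (M + 2) ≤ p := by
    rw [hrq]; exact Real.rpow_le_rpow hq0.le hqδ hα₀.le
  have hpr : p ≤ 9 * r ^ (M + 1) := by
    have h1 : p ≤ (9 * q) ^ α := Real.rpow_le_rpow hδ0.le hδq hα₀.le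
    rw [Real.mul_rpow (by norm_num) hq0.le, ← hrq] at h1
    have h2 : (9 : ℝ) ^ α ≤ 9 := by
      calc (9 : ℝ) ^ α ≤ 9 ^ (1 : ℝ) := Real.rpow_le_rpow_of_exponent_le (by norm_num) hα₁.le
        _ = 9 := Real.rpow_one 9
    have h3 : r ^ (M + 2) ≤ r ^ (M + 1) := pow_le_pow_of_le_one hr0.le hr1.le (by omega)
    calc p ≤ 9 ^ α * r ^ (M + 2) := h1
      _ ≤ 9 * r ^ (M + 1) := by gcongr
  have hH : 2 * π / 3 ^ (M + 2) = 2 * π * q := by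
    rw [hq, one_div, inv_pow]; ring
  have hHδ : 2 * π / 3 ^ (M + 2) ≤ 7 * δ := by
    rw [hH]
    have := Real.pi_lt_d2
    nlinarith [Real.pi_pos]
  obtain ⟨w, w', hw, hprod, hwd, hwd', hwm⟩ := ShearFlow.exists_increment h3r ha_upper ha_lower
    hratio hu hU M
  have hd : ∀ y, ‖w y‖ ≤ D₁ * p := fun y =>
    (hwd y).trans (mul_le_mul_of_nonneg_left hrp hD₁0)
  have hd' : ∀ y, ‖w' y‖ ≤ D₂ * p / δ := fun y => by
    refine (hwd' y).trans ?_
    have h1 : (3 * r) ^ (M + 2) ≤ 9 * p / δ := by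
      have h2 : (3 * r) ^ (M + 2) = r ^ (M + 2) / q := by
        rw [hq, mul_pow, one_div, inv_pow]; field_simp
      rw [h2, div_le_div_iff₀ hq0 hδ0]
      calc r ^ (M + 2) * δ ≤ p * (9 * q) := by gcongr
        _ = 9 * p * q := by ring
    calc _ ≤ 2 * π * C₀ / (9 * r - 1) * (9 * p / δ) := by gcongr
      _ = D₂ * p / δ := by rw [hD₂]; ring
  have hm : ∀ y : ShearFlow.Circ, p ^ 2 / 8100 ≤ ∑ j ∈ Finset.range 4,
      ‖w (y + ((j * (2 * π / 3 ^ (M + 2)) : ℝ) : ShearFlow.Circ))‖ ^ 2 := fun y => by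
    refine le_trans ?_ (hwm y)
    have : p ^ 2 ≤ (9 * r ^ (M + 1)) ^ 2 := by gcongr
    rw [mul_pow] at this
    linarith
  have hbd : b / p * (D₁ * p) ≤ 1 / 2 := by
    have : b / p * (D₁ * p) = b * D₁ := by field_simp
    rw [this]
    nlinarith [mul_nonneg hb0.le (sq_nonneg D₁), mul_nonneg hb0.le (sq_nonneg D₂)]
  have hb1 : b * (2 * D₁ + 245 * D₁ ^ 2 + 259200 * D₂ ^ 2) ≤ 2 := by linarith
  have key : ∀ κ : ℝ, 0 ≤ κ → ∀ S : ℝ → ShearFlow.L2Torus →L[ℂ] ShearFlow.L2Torus,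
      ShearFlow.IsSemigroupGeneratedBy S (ShearFlow.advectionDiffusionGraph κ ν u) →
      ∀ t : ℝ, 0 ≤ t → ‖(S t).comp (ShearFlow.modeProj k)‖ ≤
        2 * Real.exp (-(b / 777600 * lam * t)) := by
    intro κ hκ S hS t ht
    rw [← ShearFlow.coe_coefGraph κ ν hU] at hS
    have h1 := ShearFlow.norm_comp_modeProj_le hκ hν hUs hw hprod (β := b / p)
      (c := lam * b / 388800) (by positivity) (by positivity) hd hd' hm hbd (k := k)
      (fun x z _ _ => ShearFlow.scaled_dissipation hlam0 hδ0 hp0 hKp hνlam hk0.le rfl rfl rfl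
        (by positivity) hHδ hb0.le hb1) hS ht
    refine h1.trans (le_of_eq ?_)
    congr 2
    ring
  exact ⟨fun S hS t ht => key ν hν.le S hS t ht, fun R hR t ht => key 0 le_rfl R hR t ht⟩
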